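/- Let $\mathbb F$ be an algebraically closed field of characteristic $0$, $k\ge 1$, $\lambda=(\lambda_1,\dots,\lambda_k)\in(\mathbb F^\times)^k$, and let $L=H_n^\lambda$ ($n=2k+2$) be the twisted Heisenberg Lie algebra with basis $z,u_0,e_1,\hat e_1,\dots,e_k,\hat e_k$ whose only nonzero brackets are determined by $[e_i,\hat e_i]=\lambda_i z$, $[u_0,e_i]=\lambda_i\hat e_i$, $[u_0,\hat e_i]=\lambda_i e_i$. Let $l$ be even. For $u\in L$ and $c\in\mathbb F^\times$, a block $B^{\mathrm I}_l(u,c)$ is a linearly independent family $x_1,y_1,\dots,x_l,y_l$ such that, with subscripts modulo $l$, $[u,x_i]=c\,x_{i+1}$, $[u,y_i]=c\,y_{i+1}$, $[x_i,y_{-i}]=(-1)^i c\,z$ and all other brackets among the $x_i,y_j$ vanish. A block $B^{\mathrm{II}}_{l/2}(u,c)$ is a linearly independent family $a_1,\dots,a_l$ such that $[u,a_i]=c\,a_{i+1}$ (subscripts modulo $l$), $[a_i,a_{l+1-i}]=(-1)^i c\,z$ for $1\le i\le l$, and all other brackets among the $a_i$ vanish. Let $\Gamma=\Gamma(l,s,r;\beta_1,\dots,\beta_s,\alpha_1,\dots,\alpha_r)$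 be a (fine) grading of $L$ by an abelian group whose nonzero homogeneous components are the lines spanned by the elements of a basis $\{z,u\}\cup\bigcup_{j=1}^s B^{\mathrm I}_l(u,\beta_j)\cup\bigcup_{t=1}^r B^{\mathrm{II}}_{l/2}(u,\alpha_t)$ of $L$, where $z$ is central and the bracket of any two elements of different blocks is $0$. For $c\in\mathbb F^\times$ let $\hat c=c\,\mu_l$ be its class in $\mathbb F^\times/\mu_l$, where $\mu_l$ is the group of $l$-th roots of unity. Let $m_1,\dots,m_{s'}$ be the multiplicities of the distinct classes in the multiset $\{\hat\beta_1,\dots,\hat\beta_s\}$ and $n_1,\dots,n_{r'}$ those in the multiset $\{\hat\alpha_1,\dots,\hat\alpha_r\}$. The group $\prod_i S_{n_i}\times\prod_i S_{m_i}$ permutes the blocks of each type having the same class, and hence acts on $D_l^s\times\mathbb Z_2^r$ by permuting factors, where $D_l$ is the dihedral group of order $2l$; put $$\mathcal W'=\Big(\prod_{i=1}^{r'} S_{n_i}\times\prod_{i=1}^{s'} S_{m_i}\Big)\ltimes\big(D_l^s\times\mathbb Z_2^r\big).$$ Then there is a greatest positive integer $p$ such that, for some primitive $p$-th root of unity $\epsilon\in\mathbb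 F$, there are multisets $X,Y$ of classes with $$\{\hat\alpha_1,\dots,\hat\alpha_r\}=\bigcup_{t=0}^{p-1}\epsilon^tX,\qquad \{\hat\beta_1,\dots,\hat\beta_s\}=\bigcup_{t=0}^{p-1}\epsilon^tY,$$ where, for every $j$, $X\cap\epsilon^jX$ is either $\emptyset$ or $X$ and $Y\cap\epsilon^jY$ is either $\emptyset$ or $Y$. (Unions and intersections are those of multisets, with the maximum and minimum of multiplicities, so each left-hand side is the disjoint union of the distinct translates, and coinciding translates are counted once.) Let $p$ be this integer, let $\epsilon$ be any primitive $p$-th root of unity, and let $q$ be the least positive integer with $\hat\epsilon^{\,q}=\hat 1$. Then $q\mid p$, and the Weyl group $\mathcal W(\Gamma)=\mathrm{Aut}(\Gamma)/\mathrm{Stab}(\Gamma)$ (the automorphisms of $L$ permuting the homogeneous components, modulo those preserving each component) satisfies $$\mathcal W(\Gamma)\;\cong\;\frac{\mathcal W'\rtimes\mathbb Z_p}{\mathbb Z_{p/q}}.$$ Here the action of the generator of $\mathbb Z_p$ on $\mathcal W'$ is conjugation, inside $(S_s\times S_r)\ltimes(D_l^s\times\mathbb Z_2^r)$, by some pair of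 permutations $(\eta,\sigma)\in S_s\times S_r$ of the blocks with $\hat\beta_{\eta(j)}=\hat\epsilon\hat\beta_j$ and $\hat\alpha_{\sigma(t)}=\hat\epsilon\hat\alpha_t$ for all $j,t$, and the subgroup factored out is a normal subgroup isomorphic to $\mathbb Z_{p/q}$ whose projection to $\mathbb Z_p$ is $q\,\mathbb Z_p$. -/

import Mathlib

open Module

/-- The underlying space of the twisted Heisenberg algebra with parameters `lam`, in coordinates
`(z, u, e, ê)` with respect to the basis `z, u, e_1, …, e_k, ê_1, …, ê_k`. -/
@[ext]
structure TwistedHeisenberg {F : Type*} {k : ℕ} (lam : Fin k → F) where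
  cz : F
  cu : F
  ce : Fin k → F
  ch : Fin k → F

namespace TwistedHeisenberg

variable {F : Type*} [Field F] {k : ℕ} {lam : Fin k → F}

/-- The coordinates as a bijection; the linear structure is transported along it. -/
def coords (lam : Fin k → F) :
    TwistedHeisenberg lam ≃ F × F × (Fin k → F) × (Fin k → F) where
  toFun a := (a.cz, a.cu, a.ce, a.ch)
  invFun a := ⟨a.1, a.2.1, a.2.2.1, a.2.2.2⟩
  left_inv _ := rfl
  right_inv _ := rfl

instance : AddCommGroup (TwistedHeisenberg lam) := (coords lam).addCommGroup

instance : Module F (TwistedHeisenberg lam) := (coords lam).module F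

@[simp] theorem add_cz (a b : TwistedHeisenberg lam) : (a + b).cz = a.cz + b.cz := rfl
@[simp] theorem add_cu (a b : TwistedHeisenberg lam) : (a + b).cu = a.cu + b.cu := rfl
@[simp] theorem add_ce (a b : TwistedHeisenberg lam) : (a + b).ce = a.ce + b.ce := rfl
@[simp] theorem add_ch (a b : TwistedHeisenberg lam) : (a + b).ch = a.ch + b.ch := rfl
@[simp] theorem zero_cz : (0 : TwistedHeisenberg lam).cz = 0 := rfl
@[simp] theorem zero_cu : (0 : TwistedHeisenberg lam).cu = 0 := rfl
@[simp] theorem zero_ce : (0 : TwistedHeisenberg lam).ce = 0 := rfl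
@[simp] theorem zero_ch : (0 : TwistedHeisenberg lam).ch = 0 := rfl
@[simp] theorem smul_cz (c : F) (a : TwistedHeisenberg lam) : (c • a).cz = c * a.cz := rfl
@[simp] theorem smul_cu (c : F) (a : TwistedHeisenberg lam) : (c • a).cu = c * a.cu := rfl
@[simp] theorem smul_ce (c : F) (a : TwistedHeisenberg lam) : (c • a).ce = c • a.ce := rfl
@[simp] theorem smul_ch (c : F) (a : TwistedHeisenberg lam) : (c • a).ch = c • a.ch := rfl

/-- The bracket determined bilinearly by
`[e_i, ê_i] = lam_i z`, `[u, e_i] = lam_i ê_i`, `[u, ê_i] = lam_i e_i`. -/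
instance : Bracket (TwistedHeisenberg lam) (TwistedHeisenberg lam) where
  bracket a b :=
    { cz := ∑ i, lam i * (a.ce i * b.ch i - a.ch i * b.ce i)
      cu := 0
      ce := fun i => lam i * (a.cu * b.ch i - b.cu * a.ch i)
      ch := fun i => lam i * (a.cu * b.ce i - b.cu * a.ce i) }

@[simp] theorem lie_cz (a b : TwistedHeisenberg lam) :
    ⁅a, b⁆.cz = ∑ i, lam i * (a.ce i * b.ch i - a.ch i * b.ce i) := rfl
@[simp] theorem lie_cu (a b : TwistedHeisenberg lam) : ⁅a, b⁆.cu = 0 := rfl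
@[simp] theorem lie_ce (a b : TwistedHeisenberg lam) (i : Fin k) :
    ⁅a, b⁆.ce i = lam i * (a.cu * b.ch i - b.cu * a.ch i) := rfl
@[simp] theorem lie_ch (a b : TwistedHeisenberg lam) (i : Fin k) :
    ⁅a, b⁆.ch i = lam i * (a.cu * b.ce i - b.cu * a.ce i) := rfl

instance : LieRing (TwistedHeisenberg lam) where
  add_lie a b c := by
    ext
    · simp only [lie_cz, add_cz, add_ce, add_ch, Pi.add_apply, ← Finset.sum_add_distrib]
      exact Finset.sum_congr rfl fun i _ => by ring
    · simp
    · simp; ring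
    · simp; ring
  lie_add a b c := by
    ext
    · simp only [lie_cz, add_cz, add_ce, add_ch, Pi.add_apply, ← Finset.sum_add_distrib]
      exact Finset.sum_congr rfl fun i _ => by ring
    · simp
    · simp; ring
    · simp; ring
  lie_self a := by
    ext
    · simp only [lie_cz, zero_cz]
      exact Finset.sum_eq_zero fun i _ => by ring
    · simp
    · simp
    · simp
  leibniz_lie a b c := by
    ext
    · simp only [lie_cz, lie_ce, lie_ch, add_cz, ← Finset.sum_add_distrib]
      exact Finset.sum_congr rfl fun i _ => by ring
    · simp
    · simp; ring
    · simp; ring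

instance : LieAlgebra F (TwistedHeisenberg lam) where
  lie_smul c a b := by
    ext
    · simp only [lie_cz, smul_cz, smul_ce, smul_ch, Pi.smul_apply, smul_eq_mul, Finset.mul_sum]
      exact Finset.sum_congr rfl fun i _ => by ring
    · simp
    · simp; ring
    · simp; ring

end TwistedHeisenberg

section Weyl

variable {F L G : Type*} [Field F] [LieRing L] [LieAlgebra F L]

/-- The set of nonzero homogeneous components of a grading. -/
def gradingComponents (Γ : G → Submodule F L) : Set (Submodule F L) :=
  {V | V ≠ ⊥ ∧ ∃ g, Γ g = V}

/-- `Aut(Γ)`: the Lie algebra automorphisms that permute the homogeneous components of `Γ`. -/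
def gradingAut (Γ : G → Submodule F L) : Subgroup (L ≃ₗ[F] L) where
  carrier := {f | (∀ a b : L, f ⁅a, b⁆ = ⁅f a, f b⁆) ∧
    (fun V : Submodule F L => V.map (f : L →ₗ[F] L)) '' gradingComponents Γ = gradingComponents Γ}
  one_mem' := by
    refine ⟨fun _ _ => rfl, ?_⟩
    have : (fun V : Submodule F L => V.map ((1 : L ≃ₗ[F] L) : L →ₗ[F] L)) = id := by
      funext V
      exact Submodule.map_id V
    rw [this, Set.image_id]
  mul_mem' := by
    rintro f g ⟨hf, hf'⟩ ⟨hg, hg'⟩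
    refine ⟨fun a b => by simp [LinearEquiv.mul_apply, hf, hg], ?_⟩
    have : (fun V : Submodule F L => V.map ((f * g : L ≃ₗ[F] L) : L →ₗ[F] L)) =
        (fun V : Submodule F L => V.map (f : L →ₗ[F] L)) ∘
          (fun V : Submodule F L => V.map (g : L →ₗ[F] L)) := by
      funext V
      exact Submodule.map_comp _ _ V
    rw [this, Set.image_comp, hg', hf']
  inv_mem' := by
    rintro f ⟨hf, hf'⟩
    refine ⟨fun a b => ?_, ?_⟩
    · change f.symm ⁅a, b⁆ = ⁅f.symm a, f.symm b⁆
      rw [LinearEquiv.symm_apply_eq, hf]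
      simp
    · have : (fun V : Submodule F L => V.map ((f⁻¹ : L ≃ₗ[F] L) : L →ₗ[F] L)) ∘
          (fun V : Submodule F L => V.map (f : L →ₗ[F] L)) = id := by
        funext V
        change (V.map (f : L →ₗ[F] L)).map (f.symm : L →ₗ[F] L) = V
        rw [← Submodule.map_comp]
        simp
      conv_lhs => rw [← hf']
      rw [← Set.image_comp, this, Set.image_id]

/-- `Stab(Γ)`: the Lie algebra automorphisms that leave each homogeneous component invariant. -/
def gradingStab (Γ : G → Submodule F L) : Subgroup (L ≃ₗ[F] L) where
  carrier := {f | (∀ a b : L, f ⁅a, b⁆ = ⁅f a, f b⁆) ∧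
    ∀ g, (Γ g).map (f : L →ₗ[F] L) = Γ g}
  one_mem' := ⟨fun _ _ => rfl, fun g => Submodule.map_id _⟩
  mul_mem' := by
    rintro f g ⟨hf, hf'⟩ ⟨hg, hg'⟩
    refine ⟨fun a b => by simp [LinearEquiv.mul_apply, hf, hg], fun i => ?_⟩
    refine (Submodule.map_comp (g : L →ₗ[F] L) (f : L →ₗ[F] L) (Γ i)).trans ?_
    rw [hg', hf']
  inv_mem' := by
    rintro f ⟨hf, hf'⟩
    refine ⟨fun a b => ?_, fun i => ?_⟩
    · change f.symm ⁅a, b⁆ = ⁅f.symm a, f.symm b⁆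
      rw [LinearEquiv.symm_apply_eq, hf]
      simp
    · change (Γ i).map (f.symm : L →ₗ[F] L) = Γ i
      conv_lhs => rw [← hf' i]
      rw [← Submodule.map_comp]
      simp

instance gradingStab_normal (Γ : G → Submodule F L) :
    ((gradingStab Γ).subgroupOf (gradingAut Γ)).Normal where
  conj_mem := by
    rintro ⟨h, h'⟩ hh ⟨f, hf⟩
    have hh : h ∈ gradingStab Γ := hh
    change f * h * f⁻¹ ∈ gradingStab Γ
    have hf2 := (gradingAut Γ).inv_mem hf
    refine ⟨fun a b => ?_, fun i => ?_⟩
    · change f (h (f⁻¹ ⁅a, b⁆)) = ⁅f (h (f⁻¹ a)), f (h (f⁻¹ b))⁆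
      rw [hf2.1, hh.1, hf.1]
    · by_cases h0 : Γ i = ⊥
      · rw [h0, Submodule.map_bot]
      · have hi : Γ i ∈ gradingComponents Γ := ⟨h0, i, rfl⟩
        rw [← hf.2] at hi
        obtain ⟨V, ⟨-, j, rfl⟩, hj⟩ := hi
        change (Γ j).map (f : L →ₗ[F] L) = Γ i at hj
        have e1 : (Γ i).map ((f⁻¹ : L ≃ₗ[F] L) : L →ₗ[F] L) = Γ j := by
          rw [← hj]
          change ((Γ j).map (f : L →ₗ[F] L)).map (f.symm : L →ₗ[F] L) = Γ j
          rw [← Submodule.map_comp]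
          simp
        have e2 : (Γ j).map (h : L →ₗ[F] L) = Γ j := hh.2 j
        change (Γ i).map ((f : L →ₗ[F] L) ∘ₗ (h : L →ₗ[F] L) ∘ₗ
          ((f⁻¹ : L ≃ₗ[F] L) : L →ₗ[F] L)) = Γ i
        rw [Submodule.map_comp, Submodule.map_comp, e1, e2, hj]

/-- The Weyl group `Aut(Γ) / Stab(Γ)`. -/
abbrev weylGroup (Γ : G → Submodule F L) : Type _ :=
  gradingAut Γ ⧸ (gradingStab Γ).subgroupOf (gradingAut Γ)

end Weyl

section Blocks

variable {F L G : Type*} [Field F] [LieRing L] [LieAlgebra F L]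

/-- `{x_1, y_1, …, x_l, y_l}` is a block of type I, written `B_l^I(u, c)`.
The entry `i : Fin l` stands for the subscript `i + 1`, and `finRotate l` is `i ↦ i + 1` modulo `l`.
The products of the `x`'s with the `y`'s are `[x_i, y_{l-i}] = (-1)^{l-i} c z` for `i < l` and
`[x_l, y_l] = (-1)^l c z`, i.e. `[x_i, y_j] = (-1)^j c z` when `l` divides `i + j`. -/
structure IsBlockI (l : ℕ) (z u : L) (c : F) (x y : Fin l → L) : Prop where
  linearIndependent : LinearIndependent F (Sum.elim x y)
  lie_u_x : ∀ i, ⁅u, x i⁆ = c • x (finRotate l i)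
  lie_u_y : ∀ i : Fin l, (i : ℕ) + 1 < l → ⁅u, y i⁆ = c • y (finRotate l i)
  lie_u_y_last : ∀ i : Fin l, (i : ℕ) + 1 = l → ⁅u, y i⁆ = ((-1) ^ l * c) • y (finRotate l i)
  lie_x_x : ∀ i j, ⁅x i, x j⁆ = 0
  lie_y_y : ∀ i j, ⁅y i, y j⁆ = 0
  lie_x_y : ∀ i j : Fin l, ⁅x i, y j⁆ =
    if l ∣ ((i : ℕ) + 1) + ((j : ℕ) + 1) then ((-1) ^ ((j : ℕ) + 1) * c) • z else 0

/-- For even `l`, `{a_1, …, a_l}` is a block of type II with `l` elements, written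
`B_{l/2}^{II}(u, c)`. The entry `i : Fin l` stands for the subscript `i + 1`. -/
structure IsBlockII (l : ℕ) (z u : L) (c : F) (a : Fin l → L) : Prop where
  linearIndependent : LinearIndependent F a
  lie_u_a : ∀ i, ⁅u, a i⁆ = c • a (finRotate l i)
  lie_a_a : ∀ i j : Fin l, ⁅a i, a j⁆ =
    if ((i : ℕ) + 1) + ((j : ℕ) + 1) = l + 1 then ((-1) ^ ((i : ℕ) + 1) * c) • z else 0

/-- Labels for the elements of `{z, u} ∪ ⋃_{j ≤ s} {x_i^j, y_i^j} ∪ ⋃_{t ≤ r} {a_i^t}`. -/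
inductive BlockIdx (l s r : ℕ) : Type
  | z : BlockIdx l s r
  | u : BlockIdx l s r
  | x (j : Fin s) (i : Fin l) : BlockIdx l s r
  | y (j : Fin s) (i : Fin l) : BlockIdx l s r
  | a (t : Fin r) (i : Fin l) : BlockIdx l s r

/-- The block to which a label belongs (none for `z` and `u`). -/
def BlockIdx.block {l s r : ℕ} : BlockIdx l s r → Option (Fin s ⊕ Fin r)
  | .z => none
  | .u => none
  | .x j _ => some (Sum.inl j)
  | .y j _ => some (Sum.inl j)
  | .a t _ => some (Sum.inr t)

/-- The basis `b` of `L` has the form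
`{z, u} ∪ ⋃_j B_l^I(u, β_j) ∪ ⋃_t B_{l/2}^{II}(u, α_t)` with `z` central, the bracket of any two
elements of different blocks being zero. -/
structure IsBlockBasis (l s r : ℕ) (β : Fin s → Fˣ) (α : Fin r → Fˣ)
    (b : Basis (BlockIdx l s r) F L) : Prop where
  central : ∀ w : L, ⁅b .z, w⁆ = 0
  blockI : ∀ j, IsBlockI l (b .z) (b .u) (β j : F) (fun i => b (.x j i)) (fun i => b (.y j i))
  blockII : ∀ t, IsBlockII l (b .z) (b .u) (α t : F) (fun i => b (.a t i))
  different : ∀ v w B C, v.block = some B → w.block = some C → B ≠ C → ⁅b v, b w⁆ = 0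

/-- `Γ` is the grading `Γ(l, s, r; β_1, …, β_s, α_1, …, α_r)`: its nonzero homogeneous components
are the lines spanned by the elements of a block basis. -/
def IsBlockGrading (Γ : G → Submodule F L) (l s r : ℕ) (β : Fin s → Fˣ) (α : Fin r → Fˣ) : Prop :=
  ∃ b : Basis (BlockIdx l s r) F L, IsBlockBasis l s r β α b ∧
    gradingComponents Γ = Set.range fun v => Submodule.span F {b v}

end Blocks

section Splitting

variable {F : Type*} [Field F]

/-- The class `{c ξ^t : 0 ≤ t < l}` of `c`, `ξ` a primitive `l`-th root of unity, as an element of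
the group `Fˣ / μ_l`. -/
def hatClass (l : ℕ) (c : Fˣ) : Fˣ ⧸ rootsOfUnity l F := QuotientGroup.mk c

/-- The family of classes `c X`, for a family (multiset) `X` of classes. -/
def translateClasses (l : ℕ) (c : Fˣ) (X : Multiset (Fˣ ⧸ rootsOfUnity l F)) :
    Multiset (Fˣ ⧸ rootsOfUnity l F) :=
  X.map fun a => hatClass l c * a

open Classical in
/-- The family `A` of classes is the union of `X, ε X, …, ε^{p-1} X`, where `X ∩ ε^j X` is either
empty or `X` for each `j`. Union and intersection of multisets take the maximum and the minimum
of the multiplicities, so equal translates are counted once. -/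
def SplitsBy (l p : ℕ) (ε : Fˣ) (A : Multiset (Fˣ ⧸ rootsOfUnity l F)) : Prop :=
  ∃ X : Multiset (Fˣ ⧸ rootsOfUnity l F),
    A = (Finset.range p).sup (fun t => translateClasses l (ε ^ t) X) ∧
    ∀ j : ℕ, X ∩ translateClasses l (ε ^ j) X = 0 ∨ X ∩ translateClasses l (ε ^ j) X = X

/-- The positive integers `p` such that, for a primitive `p`-th root of unity `ε`, both
`{β̂_1, …, β̂_s}` and `{α̂_1, …, α̂_r}` split. -/
def splittingOrders (l : ℕ) {s r : ℕ} (β : Fin s → Fˣ) (α : Fin r → Fˣ) : Set ℕ :=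
  {p | 0 < p ∧ ∃ ε : Fˣ, IsPrimitiveRoot ε p ∧
    SplitsBy l p ε (Finset.univ.val.map fun t => hatClass l (α t)) ∧
    SplitsBy l p ε (Finset.univ.val.map fun j => hatClass l (β j))}

end Splitting

section Groups

/-- `D_l^s × ℤ_2^r`. -/
abbrev BlockGroup (l s r : ℕ) : Type :=
  (Fin s → DihedralGroup l) × (Fin r → Multiplicative (ZMod 2))

/-- Permutations act on `D_l^s × ℤ_2^r` by permuting the factors. -/
def permAction (l s r : ℕ) :
    Equiv.Perm (Fin s) × Equiv.Perm (Fin r) →* MulAut (BlockGroup l s r) where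
  toFun g := MulEquiv.prodCongr (mulAutArrow g.1) (mulAutArrow g.2)
  map_one' := by
    ext x : 1
    simp only [Prod.fst_one, Prod.snd_one, map_one]
    rfl
  map_mul' g h := by
    ext x : 1
    simp only [Prod.fst_mul, Prod.snd_mul, map_mul]
    rfl

/-- `(S_s × S_r) ⋉ (D_l^s × ℤ_2^r)`. -/
abbrev FullBlockGroup (l s r : ℕ) : Type :=
  BlockGroup l s r ⋊[permAction l s r] (Equiv.Perm (Fin s) × Equiv.Perm (Fin r))

variable {s r s' r' : ℕ} {m : Fin s' → ℕ} {n : Fin r' → ℕ}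

/-- `∏ S_{m_i} × ∏ S_{n_i}` as permutations of the blocks, where `eβ` and `eα` say which blocks
belong to which factor. -/
def youngHom (eβ : (Σ i, Fin (m i)) ≃ Fin s) (eα : (Σ i, Fin (n i)) ≃ Fin r) :
    (∀ i, Equiv.Perm (Fin (m i))) × (∀ i, Equiv.Perm (Fin (n i))) →*
      Equiv.Perm (Fin s) × Equiv.Perm (Fin r) :=
  MonoidHom.prodMap
    (eβ.permCongrHom.toMonoidHom.comp (Equiv.Perm.sigmaCongrRightHom fun i => Fin (m i)))
    (eα.permCongrHom.toMonoidHom.comp (Equiv.Perm.sigmaCongrRightHom fun i => Fin (n i)))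

/-- `(∏ S_{n_i} × ∏ S_{m_i}) ⋉ (D_l^s × ℤ_2^r)`. -/
abbrev InnerGroup (l : ℕ) (eβ : (Σ i, Fin (m i)) ≃ Fin s) (eα : (Σ i, Fin (n i)) ≃ Fin r) : Type :=
  BlockGroup l s r ⋊[(permAction l s r).comp (youngHom eβ eα)]
    ((∀ i, Equiv.Perm (Fin (m i))) × (∀ i, Equiv.Perm (Fin (n i))))

/-- The inclusion of `InnerGroup` in `FullBlockGroup`. -/
def innerToFull (l : ℕ) (eβ : (Σ i, Fin (m i)) ≃ Fin s) (eα : (Σ i, Fin (n i)) ≃ Fin r) :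
    InnerGroup l eβ eα →* FullBlockGroup l s r :=
  SemidirectProduct.map (MonoidHom.id _) (youngHom eβ eα) fun _ => rfl

end Groups

/-!
The twisted Heisenberg algebra enters only through its block basis. Label the lines inside the
blocks so that the lines of a block of type I form a torsor under the dihedral group (`x_i` is
`r i`, `y_i` is `sr i`) and those of a block of type II are indexed by `ℤ_l`. In a block of type I
the operator `ad u` then acts on lines as right multiplication by a rotation, and passing to the
only line with which a given line does not commute is right multiplication by a reflection. Hence
the permutations of the lines compatible with both are, block by block, left multiplications, and
together they form `(S_s × S_r) ⋉ (D_l^s × ℤ_2^r)` (`BlockLine.exists_act_eq`).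

An automorphism that permutes the homogeneous lines fixes the line of `z` (the centre) and that
of `u` (the only one outside the derived algebra), hence induces such a symmetry. If `u` is
multiplied by `μ`, comparing the action of `(ad u)^l` shows that the `l`-th power of the parameter
of each block is `μ^l` times that of the image block. Conversely every symmetry with this property
is induced by an automorphism, since square roots exist in the field. So the Weyl group is the group
of symmetries that translate the classes of the parameters by a common class
(`IsAdaptedBasis.exists_weylGroup_hom`).

The classes by which both multisets of classes can be translated form a finite group, and the
scalars representing them form a finite subgroup of the multiplicative group of the field, so a
cyclic one. A multiset splits into the translates of some `X` by the powers of `ε` exactly when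
`ε` preserves it (`exists_eq_sup_translates_iff`), so the order of this cyclic group of scalars is
the greatest possible `p`, and a primitive `p`-th root of unity `ε` generates it. Numbering the
blocks inside each class, `ε` acts by the unique permutations `η`, `σ` of the blocks that keep these
numbers; uniqueness gives `η^q = σ^q = 1`. Therefore `ℤ_p` acts through `ℤ_q`, the natural map from
`𝒲' ⋊ ℤ_p` to the group of symmetries has the Weyl group as its image, and its kernel is the copy of
`q ℤ_p` inside the factor `ℤ_p` (`exists_semidirectProduct_hom`).
-/

open Module


/-! ### Characters of cyclic groups -/

section Cyclic

variable {M : Type*} [Monoid M] {n : ℕ}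

/-- The power `g ^ i` for a residue class `i` modulo `n`, computed with the least nonnegative
representative; it is multiplicative in `i` when `g ^ n = 1`. -/
def zmodPow (g : M) (i : ZMod n) : M := g ^ i.val

theorem zmodPow_add [NeZero n] {g : M} (hg : g ^ n = 1) (i j : ZMod n) :
    zmodPow g (i + j) = zmodPow g i * zmodPow g j := by
  rw [zmodPow, zmodPow, zmodPow, ← pow_add, ZMod.val_add]
  exact (pow_eq_pow_mod _ hg).symm

theorem zmodPow_zero (g : M) : zmodPow g (0 : ZMod n) = 1 := by simp [zmodPow]

theorem zmodPow_natCast {g : M} (hg : g ^ n = 1) (k : ℕ) :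
    zmodPow g (k : ZMod n) = g ^ k := by
  rw [zmodPow, ZMod.val_natCast]
  exact (pow_eq_pow_mod _ hg).symm

theorem zmodPow_one {g : M} (hg : g ^ n = 1) : zmodPow g (1 : ZMod n) = g := by
  simpa using zmodPow_natCast hg 1

/-- The homomorphism from the cyclic group of order `n` that sends the generator to `g`. -/
def zmodPowHom [NeZero n] (g : M) (hg : g ^ n = 1) : Multiplicative (ZMod n) →* M where
  toFun i := zmodPow g i.toAdd
  map_one' := zmodPow_zero g
  map_mul' i j := zmodPow_add hg i.toAdd j.toAdd

end Cyclic

/-! ### Multisets in a group that are invariant under translation -/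

section Invariant

variable {C : Type*} [CommGroup C]

/-- The subgroup of all `h` such that translation by `h` preserves the multiset `A`. -/
def multisetStabilizer (A : Multiset C) : Subgroup C where
  carrier := {h | A.map (h * ·) = A}
  one_mem' := by simp
  mul_mem' {a b} ha hb := by
    change A.map (a * b * ·) = A
    simp only [mul_assoc]
    conv_rhs => rw [← ha, ← hb, Multiset.map_map]
    rfl
  inv_mem' {a} ha := by
    change A.map (a⁻¹ * ·) = A
    conv_lhs => rw [← ha, Multiset.map_map]
    simp

theorem mem_multisetStabilizer_iff_count_eq [DecidableEq C] {A : Multiset C} {h : C} :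
    h ∈ multisetStabilizer A ↔ ∀ c, A.count (h * c) = A.count c := by
  have hmap : ∀ c, (A.map (h * ·)).count (h * c) = A.count c :=
    Multiset.count_map_eq_count' (h * ·) A (mul_right_injective h)
  constructor
  · intro hh c
    rw [← hmap c, show A.map (h * ·) = A from hh]
  · intro hh
    change A.map (h * ·) = A
    ext c
    rw [← mul_inv_cancel_left h c, hmap, hh]

/-- A translation that preserves a nonempty finite multiset is determined by the image of one
element, so there are finitely many. -/
theorem finite_multisetStabilizer {A : Multiset C} (hA : A ≠ 0) :
    Finite (multisetStabilizer A) := by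
  classical
  obtain ⟨c, hc⟩ := Multiset.exists_mem_of_ne_zero hA
  have hmem : ∀ h : multisetStabilizer A, (h : C) * c ∈ A.toFinset := fun h => by
    rwa [Multiset.mem_toFinset, ← Multiset.count_pos, mem_multisetStabilizer_iff_count_eq.1 h.2 c,
      Multiset.count_pos]
  refine Finite.of_injective (fun h => (⟨(h : C) * c, hmem h⟩ : A.toFinset)) fun h h' e => ?_
  exact Subtype.ext (mul_right_cancel (congrArg Subtype.val e))

/-- For an element `e` of finite order, `A` is a union of translates `e ^ t X` of a multiset `X`
that meets its translates in `∅` or `X` exactly when `e` preserves `A`: one takes for `X` the part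
of `A` supported on a set of representatives of the cosets of `⟨e⟩`. -/
theorem exists_eq_sup_translates_iff [DecidableEq C] {A : Multiset C} {e : C} {p : ℕ} (hp : 0 < p)
    (he : e ^ p = 1) :
    (∃ X : Multiset C, A = (Finset.range p).sup (fun t => X.map (e ^ t * ·)) ∧
      ∀ j : ℕ, X ∩ X.map (e ^ j * ·) = 0 ∨ X ∩ X.map (e ^ j * ·) = X) ↔
    e ∈ multisetStabilizer A := by
  have hcount : ∀ (X : Multiset C) (t : ℕ) (c : C),
      (X.map (e ^ t * ·)).count c = X.count ((e ^ t)⁻¹ * c) := fun X t c => by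
    have := Multiset.count_map_eq_count' (e ^ t * ·) X (mul_right_injective _) ((e ^ t)⁻¹ * c)
    rwa [mul_inv_cancel_left] at this
  constructor
  · rintro ⟨X, rfl, -⟩
    set A := (Finset.range p).sup (fun t => X.map (e ^ t * ·)) with hA
    have hle : ∀ c, A.count c ≤ A.count (e * c) := fun c => by
      rw [hA, Multiset.count_finset_sup, Multiset.count_finset_sup]
      refine Finset.sup_le fun t _ => ?_
      have hmod : e ^ ((t + 1) % p) = e ^ t * e := by
        rw [← pow_succ]; exact (pow_eq_pow_mod _ he).symm
      refine le_trans (le_of_eq ?_) (Finset.le_sup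
        (f := fun t => Multiset.count (e * c) (X.map (e ^ t * ·)))
        (Finset.mem_range.2 (Nat.mod_lt (t + 1) hp)))
      rw [hcount, hcount, hmod, mul_inv, mul_assoc, inv_mul_cancel_left]
    have hpow : ∀ (n : ℕ) c, A.count c ≤ A.count (e ^ n * c) := fun n c => by
      induction n with
      | zero => simp
      | succ n ih => rw [pow_succ', mul_assoc]; exact ih.trans (hle _)
    rw [mem_multisetStabilizer_iff_count_eq]
    intro c
    refine le_antisymm ?_ (hle c)
    have := hpow (p - 1) (e * c)
    rwa [← mul_assoc, ← pow_succ, Nat.sub_add_cancel hp, he, one_mul] at this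
  · intro hA
    have hApow : ∀ (n : ℕ) c, A.count ((e ^ n)⁻¹ * c) = A.count c := fun n c =>
      mem_multisetStabilizer_iff_count_eq.1
        ((multisetStabilizer A).inv_mem ((multisetStabilizer A).pow_mem hA n)) c
    -- A fixed representative of each coset of `⟨e⟩`.
    let rep : C → C := fun c => (QuotientGroup.mk c : C ⧸ Subgroup.zpowers e).out
    have hrep : ∀ c d, d⁻¹ * c ∈ Subgroup.zpowers e → rep d = rep c := fun c d h => by
      simp only [rep]
      rw [QuotientGroup.eq.2 h]
    have hrep' : ∀ c, ∃ t < p, (e ^ t)⁻¹ * c = rep c := fun c => by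
      have h1 : (rep c)⁻¹ * c ∈ Subgroup.zpowers e :=
        QuotientGroup.eq.1 (QuotientGroup.out_eq' (QuotientGroup.mk c : C ⧸ Subgroup.zpowers e))
      have hfin : IsOfFinOrder e := isOfFinOrder_iff_pow_eq_one.2 ⟨p, hp, he⟩
      obtain ⟨n, hn⟩ := (Submonoid.mem_powers_iff _ _).1
        ((hfin.mem_powers_iff_mem_zpowers).2 h1)
      refine ⟨n % p, Nat.mod_lt _ hp, ?_⟩
      rw [← pow_eq_pow_mod _ he, hn]
      simp
    have hX : ∀ c, (A.filter (fun c => c = rep c)).count c = if c = rep c then A.count c else 0 :=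
      fun c => Multiset.count_filter
    have hpowmem : ∀ (n : ℕ) (c : C), c⁻¹ * ((e ^ n)⁻¹ * c) ∈ Subgroup.zpowers e := fun n c => by
      rw [mul_left_comm, inv_mul_cancel, mul_one]
      exact (Subgroup.zpowers e).inv_mem ((Subgroup.zpowers e).pow_mem
        (Subgroup.mem_zpowers e) n)
    refine ⟨A.filter (fun c => c = rep c), ?_, fun j => ?_⟩
    · ext c
      rw [Multiset.count_finset_sup]
      refine le_antisymm ?_ (Finset.sup_le fun t _ => ?_)
      · obtain ⟨t, ht, htc⟩ := hrep' c
        refine le_trans (le_of_eq ?_) (Finset.le_sup (Finset.mem_range.2 ht))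
        have h2 : rep c = rep ((e ^ t)⁻¹ * c) := hrep _ _ (hpowmem t c)
        rw [hcount, hX, if_pos (htc.trans h2), hApow]
      · rw [hcount, hX]
        split_ifs
        · rw [hApow]
        · exact Nat.zero_le _
    · by_cases hj : e ^ j = 1
      · right
        rw [hj]
        simp only [one_mul, Multiset.map_id']
        exact inf_idem _
      · left
        rw [Multiset.eq_zero_iff_forall_notMem]
        intro c hc
        rw [Multiset.mem_inter, Multiset.mem_map] at hc
        obtain ⟨hc, d, hd, hdc⟩ := hc
        have h1 : c = rep c := (Multiset.mem_filter.1 hc).2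
        have h2 : d = rep d := (Multiset.mem_filter.1 hd).2
        have h3 : rep c = rep d := by
          refine hrep _ _ ?_
          have := hpowmem j c
          rwa [← hdc, inv_mul_cancel_left, hdc] at this
        rw [← h1, ← h2] at h3
        rw [h3] at hdc
        exact hj (mul_eq_right.1 hdc)

end Invariant

section Orders

variable {F : Type*} [Field F]

open Classical in
theorem splitsBy_iff {l p : ℕ} (hp : 0 < p) {ε : Fˣ} (hε : ε ^ p = 1)
    (A : Multiset (Fˣ ⧸ rootsOfUnity l F)) :
    SplitsBy l p ε A ↔ hatClass l ε ∈ multisetStabilizer A := by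
  have he : hatClass l ε ^ p = 1 := by
    rw [hatClass, ← QuotientGroup.mk_pow, hε, QuotientGroup.mk_one]
  rw [← exists_eq_sup_translates_iff hp he]
  simp only [SplitsBy, translateClasses, hatClass, QuotientGroup.mk_pow]

/-- The scalars whose classes preserve both families of classes. -/
noncomputable def scalingSubgroup (l : ℕ) {s r : ℕ} (β : Fin s → Fˣ) (α : Fin r → Fˣ) :
    Subgroup Fˣ :=
  (multisetStabilizer (Finset.univ.val.map fun t => hatClass l (α t)) ⊓
    multisetStabilizer (Finset.univ.val.map fun j => hatClass l (β j))).comap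
      (QuotientGroup.mk' (rootsOfUnity l F))

theorem finite_scalingSubgroup {l s r : ℕ} (hl : 0 < l) (hsr : 0 < s ∨ 0 < r) (β : Fin s → Fˣ)
    (α : Fin r → Fˣ) : Finite (scalingSubgroup l β α) := by
  have hfin : Finite ↥(multisetStabilizer (Finset.univ.val.map fun t => hatClass l (α t)) ⊓
      multisetStabilizer (Finset.univ.val.map fun j => hatClass l (β j))) := by
    rcases hsr with h | h
    · have : Finite (multisetStabilizer (Finset.univ.val.map fun j => hatClass l (β j))) := by
        refine finite_multisetStabilizer fun h0 => ?_
        have := congrArg Multiset.card h0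
        simp only [Multiset.card_map, Finset.card_val, Finset.card_univ, Fintype.card_fin,
          Multiset.card_zero] at this
        omega
      exact Finite.of_injective _ (Subgroup.inclusion_injective inf_le_right)
    · have : Finite (multisetStabilizer (Finset.univ.val.map fun t => hatClass l (α t))) := by
        refine finite_multisetStabilizer fun h0 => ?_
        have := congrArg Multiset.card h0
        simp only [Multiset.card_map, Finset.card_val, Finset.card_univ, Fintype.card_fin,
          Multiset.card_zero] at this
        omega
      exact Finite.of_injective _ (Subgroup.inclusion_injective inf_le_left)
  set S := multisetStabilizer (Finset.univ.val.map fun t => hatClass l (α t)) ⊓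
      multisetStabilizer (Finset.univ.val.map fun j => hatClass l (β j)) with hS
  have hN : 0 < Nat.card S := Nat.card_pos
  have : NeZero (Nat.card S * l) := ⟨(Nat.mul_pos hN hl).ne'⟩
  have hle : scalingSubgroup l β α ≤ rootsOfUnity (Nat.card S * l) F := fun μ hμ => by
    have h1 : (⟨_, hμ⟩ : S) ^ Nat.card S = 1 := pow_card_eq_one'
    have h2 : QuotientGroup.mk' (rootsOfUnity l F) μ ^ Nat.card S = 1 := congrArg Subtype.val h1
    rw [← map_pow, QuotientGroup.mk'_apply, QuotientGroup.eq_one_iff, mem_rootsOfUnity,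
      ← pow_mul] at h2
    exact h2
  exact Finite.of_injective _ (Subgroup.inclusion_injective hle)

/-- The orders of the finite cyclic group `scalingSubgroup l β α` and of its subgroups are the
possible values of `p`. -/
theorem exists_isGreatest_splittingOrders {l s r : ℕ} (hl : 0 < l) (hsr : 0 < s ∨ 0 < r)
    (β : Fin s → Fˣ) (α : Fin r → Fˣ) :
    ∃ p : ℕ, IsGreatest (splittingOrders l β α) p ∧ 0 < p ∧
      ∀ μ ∈ scalingSubgroup l β α, μ ^ p = 1 := by
  have := finite_scalingSubgroup hl hsr β α
  have hiff : ∀ {p : ℕ}, 0 < p → ∀ {ε : Fˣ}, IsPrimitiveRoot ε p →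
      ((SplitsBy l p ε (Finset.univ.val.map fun t => hatClass l (α t)) ∧
        SplitsBy l p ε (Finset.univ.val.map fun j => hatClass l (β j))) ↔
          ε ∈ scalingSubgroup l β α) := fun hp ε hε => by
    rw [splitsBy_iff hp hε.pow_eq_one, splitsBy_iff hp hε.pow_eq_one]
    rfl
  refine ⟨Nat.card (scalingSubgroup l β α), ⟨⟨Nat.card_pos, ?_⟩, ?_⟩, Nat.card_pos, ?_⟩
  · obtain ⟨g, hg⟩ := IsCyclic.exists_ofOrder_eq_natCard (α := scalingSubgroup l β α)
    have hprim : IsPrimitiveRoot (g : Fˣ) (Nat.card (scalingSubgroup l β α)) := by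
      rw [← hg, ← Subgroup.orderOf_coe]
      exact IsPrimitiveRoot.orderOf _
    exact ⟨g, hprim, (hiff Nat.card_pos hprim).2 g.2⟩
  · rintro p ⟨hp, ε, hε, h⟩
    have h1 := (hiff hp hε).1 h
    rw [hε.eq_orderOf, ← Subgroup.orderOf_mk ε h1]
    exact Nat.le_of_dvd Nat.card_pos (orderOf_dvd_natCard _)
  · intro μ hμ
    exact congrArg Subtype.val (pow_card_eq_one' (x := (⟨μ, hμ⟩ : scalingSubgroup l β α)))

end Orders

/-! ### Permutations of a labelled family that translate the labels -/

section Labels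

variable {C ι : Type*} [CommGroup C] [Fintype ι] {s' : ℕ} {m : Fin s' → ℕ} {x : ι → C}
  {d : Fin s' → C} (e : (Σ i, Fin (m i)) ≃ ι)

theorem mem_multisetStabilizer_of_perm {h : C} (η : Equiv.Perm ι) (hη : ∀ j, x (η j) = h * x j) :
    h ∈ multisetStabilizer (Finset.univ.val.map x) := by
  change (Finset.univ.val.map x).map (h * ·) = _
  rw [Multiset.map_map]
  have : ((h * ·) ∘ x) = x ∘ η := by
    funext j
    exact (hη j).symm
  rw [this, ← Multiset.map_map]
  congr 1
  exact congrArg Finset.val (Finset.map_univ_equiv η)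

omit [CommGroup C] in
open Classical in
include e in
/-- The number `m i` is the multiplicity of the label `d i`. -/
theorem count_label (hd : Function.Injective d) (hx : ∀ i, x (e i) = d i.1) (i : Fin s') :
    (Finset.univ.val.map x).count (d i) = m i := by
  have h1 : Finset.univ.val.map x = (Finset.univ : Finset (Σ i, Fin (m i))).val.map
      fun i => d i.1 := by
    rw [← show x ∘ e = fun i => d i.1 from funext hx, ← Multiset.map_map]
    congr 1
    exact (congrArg Finset.val (Finset.map_univ_equiv e)).symm
  have h2 : (Finset.univ.filter fun a : Σ i, Fin (m i) => d i = d a.1) =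
      (Finset.univ : Finset (Fin (m i))).map (Function.Embedding.sigmaMk i) := by
    ext ⟨i', k⟩
    simp only [Finset.mem_filter, Finset.mem_univ, true_and, Finset.mem_map,
      Function.Embedding.sigmaMk_apply, hd.eq_iff]
    constructor
    · rintro rfl
      exact ⟨k, rfl⟩
    · rintro ⟨a, ha⟩
      exact (Sigma.mk.inj_iff.1 ha).1
  rw [h1, Multiset.count_map, ← Finset.filter_val, h2]
  simp

omit [CommGroup C] [Fintype ι] in
/-- An index is determined by its label and its position among the indices with this label. -/
theorem label_position_injective (hd : Function.Injective d) (hx : ∀ i, x (e i) = d i.1)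
    {j j' : ι} (h : x j = x j') (h' : ((e.symm j).2 : ℕ) = (e.symm j').2) : j = j' := by
  rw [← e.apply_symm_apply j, ← e.apply_symm_apply j'] at h ⊢
  generalize e.symm j = a at h h'
  generalize e.symm j' = a' at h h'
  obtain ⟨i, k⟩ := a
  obtain ⟨i', k'⟩ := a'
  rw [hx, hx] at h
  obtain rfl := hd h
  obtain rfl : k = k' := Fin.ext h'
  rfl

/-- A translation that preserves the multiset of labels is induced by a permutation of the indices
which moreover keeps the position of an index among those with the same label. Such a permutation
is unique, so its order divides that of the translation. -/
theorem exists_perm_label_position (hd : Function.Injective d) (hx : ∀ i, x (e i) = d i.1) {h : C}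
    (hh : h ∈ multisetStabilizer (Finset.univ.val.map x)) :
    ∃ η : Equiv.Perm ι, (∀ j, x (η j) = h * x j) ∧
      ∀ j, ((e.symm (η j)).2 : ℕ) = (e.symm j).2 := by
  classical
  have key : ∀ j, ∃ j', x j' = h * x j ∧ ((e.symm j').2 : ℕ) = (e.symm j).2 := fun j => by
    obtain ⟨⟨i, k⟩, rfl⟩ := e.surjective j
    have h1 : (Finset.univ.val.map x).count (h * d i) = m i := by
      rw [mem_multisetStabilizer_iff_count_eq.1 hh]
      convert count_label e hd hx i
    have hm : 0 < m i := k.pos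
    rw [← h1, Multiset.count_pos, Multiset.mem_map] at hm
    obtain ⟨j', -, hj'⟩ := hm
    obtain ⟨⟨i', k'⟩, rfl⟩ := e.surjective j'
    have h2 : d i' = h * d i := (hx ⟨i', k'⟩).symm.trans hj'
    have h3 : m i' = m i := by rw [← h1, ← h2, count_label e hd hx i']
    refine ⟨e ⟨i', Fin.cast h3.symm k⟩, ?_, ?_⟩
    · rw [hx, hx, ← h2]
    · rw [Equiv.symm_apply_apply, Equiv.symm_apply_apply]
      rfl
  choose f hf hf' using key
  have hinj : Function.Injective f := fun j j' hjj => by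
    refine label_position_injective e hd hx ?_ ?_
    · exact mul_left_cancel ((hf j).symm.trans ((congrArg x hjj).trans (hf j')))
    · exact (hf' j).symm.trans ((congrArg (fun a => ((e.symm a).2 : ℕ)) hjj).trans (hf' j'))
  exact ⟨Equiv.ofBijective f (Finite.injective_iff_bijective.1 hinj), hf, hf'⟩

omit [Fintype ι] in
theorem label_perm_pow {h : C} {η : Equiv.Perm ι} (hη : ∀ j, x (η j) = h * x j) (n : ℕ) (j : ι) :
    x ((η ^ n) j) = h ^ n * x j := by
  induction n with
  | zero => simp
  | succ n ih => rw [pow_succ', Equiv.Perm.mul_apply, hη, ih, pow_succ', mul_assoc]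

omit [Fintype ι] in
theorem perm_pow_eq_one_of_label_position (hd : Function.Injective d)
    (hx : ∀ i, x (e i) = d i.1) {h : C} {η : Equiv.Perm ι} (hη : ∀ j, x (η j) = h * x j)
    (hη' : ∀ j, ((e.symm (η j)).2 : ℕ) = (e.symm j).2) {n : ℕ} (hn : h ^ n = 1) : η ^ n = 1 := by
  have hpos : ∀ (n : ℕ) j, ((e.symm ((η ^ n) j)).2 : ℕ) = (e.symm j).2 := fun n j => by
    induction n with
    | zero => rfl
    | succ n ih => rw [pow_succ', Equiv.Perm.mul_apply, hη', ih]
  ext1 j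
  refine label_position_injective e hd hx ?_ ?_
  · rw [label_perm_pow hη, hn, one_mul, Equiv.Perm.one_apply]
  · rw [hpos, Equiv.Perm.one_apply]

omit [Fintype ι] in
theorem sigmaCongrRight_permCongr_apply (ρ : ∀ i, Equiv.Perm (Fin (m i))) (i : Fin s')
    (k : Fin (m i)) : (e.permCongrHom.toMonoidHom.comp
      (Equiv.Perm.sigmaCongrRightHom fun i => Fin (m i))) ρ (e ⟨i, k⟩) = e ⟨i, ρ i k⟩ := by
  change e ((Equiv.Perm.sigmaCongrRightHom fun i => Fin (m i)) ρ (e.symm (e ⟨i, k⟩))) = _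
  rw [Equiv.symm_apply_apply]
  rfl

omit [CommGroup C] [Fintype ι] in
/-- The product of the symmetric groups on the sets of indices with a common label consists of the
permutations that preserve labels. -/
theorem mem_range_sigmaCongrRightHom_iff (hd : Function.Injective d) (hx : ∀ i, x (e i) = d i.1)
    (η : Equiv.Perm ι) :
    η ∈ (e.permCongrHom.toMonoidHom.comp
      (Equiv.Perm.sigmaCongrRightHom fun i => Fin (m i))).range ↔ ∀ j, x (η j) = x j := by
  constructor
  · rintro ⟨ρ, rfl⟩ j
    obtain ⟨⟨i, k⟩, rfl⟩ := e.surjective j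
    rw [sigmaCongrRight_permCongr_apply, hx, hx]
  · intro h
    have key : ∀ i k, ∃ k', η (e ⟨i, k⟩) = e ⟨i, k'⟩ := fun i k => by
      obtain ⟨⟨i', k'⟩, hk'⟩ := e.surjective (η (e ⟨i, k⟩))
      have h1 := h (e ⟨i, k⟩)
      rw [← hk', hx, hx] at h1
      obtain rfl := hd h1
      exact ⟨k', hk'.symm⟩
    choose ρ hρ using key
    have hinj : ∀ i, Function.Injective (ρ i) := fun i k k' hkk => by
      have h1 : e ⟨i, k⟩ = e ⟨i, k'⟩ := η.injective (by rw [hρ, hρ, hkk])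
      simpa using h1
    refine ⟨fun i => Equiv.ofBijective (ρ i) (Finite.injective_iff_bijective.1 (hinj i)), ?_⟩
    ext1 j
    obtain ⟨⟨i, k⟩, rfl⟩ := e.surjective j
    rw [hρ, sigmaCongrRight_permCongr_apply]
    rfl

end Labels

/-! ### Extending an inclusion of groups by a cyclic group acting by conjugation -/

section Conj

variable {N M T : Type*} [Group N] [Group M] [Group T]

theorem exists_mulAut_of_conj (i : N →* M) (hi : Function.Injective i) (τ : T →* M)
    (h : ∀ t w, τ t * i w * (τ t)⁻¹ ∈ i.range) :
    ∃ φ : T →* MulAut N, ∀ t w, i (φ t w) = τ t * i w * (τ t)⁻¹ := by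
  choose f hf using h
  have hmul : ∀ t t' w, f t (f t' w) = f (t * t') w := fun t t' w => hi (by
    rw [hf, hf, hf, map_mul]; group)
  have hone : ∀ w, f 1 w = w := fun w => hi (by rw [hf, map_one]; group)
  refine ⟨{ toFun := fun t =>
              { toFun := f t
                invFun := f t⁻¹
                left_inv := fun w => by rw [hmul, inv_mul_cancel, hone]
                right_inv := fun w => by rw [hmul, mul_inv_cancel, hone]
                map_mul' := fun w w' => hi (by rw [hf, map_mul, map_mul, hf, hf]; group) }
            map_one' := MulEquiv.ext hone
            map_mul' := fun t t' => MulEquiv.ext fun w => (hmul t t' w).symm }, hf⟩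

/-- If exactly the elements of `q ℤ_p` are mapped into the image of `N`, the kernel of
`N ⋊ ℤ_p → M` projects isomorphically onto `q ℤ_p`, because `N → M` is injective. -/
theorem exists_quotient_mulEquiv_range {p q : ℕ} (hp : 0 < p) (hqp : q ∣ p) (i : N →* M)
    (hi : Function.Injective i) (τ : Multiplicative (ZMod p) →* M)
    (φ : Multiplicative (ZMod p) →* MulAut N) (hφ : ∀ t w, i (φ t w) = τ t * i w * (τ t)⁻¹)
    (hτ : ∀ t, τ t ∈ i.range ↔ t ∈ Subgroup.zpowers (Multiplicative.ofAdd (q : ZMod p))) :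
    ∃ (Ψ : N ⋊[φ] Multiplicative (ZMod p) →* M), (∀ g, Ψ g = i g.left * τ g.right) ∧
      Ψ.ker.map SemidirectProduct.rightHom = Subgroup.zpowers (Multiplicative.ofAdd (q : ZMod p)) ∧
      Nonempty (Ψ.ker ≃* Multiplicative (ZMod (p / q))) := by
  have hlift : ∀ g, i.comp (MulEquiv.toMonoidHom (φ g)) =
      (MulEquiv.toMonoidHom (MulAut.conj (τ g))).comp i := fun g => by
    ext w
    simp [hφ]
  have hΨ : ∀ g, SemidirectProduct.lift i τ hlift g = i g.left * τ g.right := fun g => rfl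
  have hmap : (SemidirectProduct.lift i τ hlift).ker.map SemidirectProduct.rightHom =
      Subgroup.zpowers (Multiplicative.ofAdd (q : ZMod p)) := by
    ext t
    rw [← hτ, Subgroup.mem_map]
    constructor
    · rintro ⟨g, hg, rfl⟩
      rw [MonoidHom.mem_ker, hΨ] at hg
      exact ⟨g.left⁻¹, by rw [map_inv]; exact inv_eq_of_mul_eq_one_right hg⟩
    · rintro ⟨w, hw⟩
      refine ⟨⟨w⁻¹, t⟩, ?_, rfl⟩
      rw [MonoidHom.mem_ker, hΨ, map_inv, hw, inv_mul_cancel]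
  refine ⟨SemidirectProduct.lift i τ hlift, hΨ, hmap, ?_⟩
  have hker : Function.Injective
      (SemidirectProduct.rightHom.comp (SemidirectProduct.lift i τ hlift).ker.subtype) := by
    rw [injective_iff_map_eq_one]
    rintro ⟨g, hg⟩ h1
    change g.right = 1 at h1
    rw [MonoidHom.mem_ker, hΨ, h1, map_one, mul_one] at hg
    refine Subtype.ext (SemidirectProduct.ext (hi ?_) h1)
    simpa using hg
  have e1 := MonoidHom.ofInjective hker
  rw [MonoidHom.range_comp, Subgroup.range_subtype, hmap] at e1
  have : NeZero p := ⟨hp.ne'⟩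
  have hq : 0 < q := Nat.pos_of_dvd_of_pos hqp hp
  have : NeZero (p / q) := ⟨(Nat.div_pos (Nat.le_of_dvd hp hqp) hq).ne'⟩
  refine ⟨e1.trans (mulEquivOfCyclicCardEq ?_)⟩
  rw [Nat.card_zpowers, orderOf_ofAdd_eq_addOrderOf, ZMod.addOrderOf_coe q hp.ne',
    Nat.gcd_eq_right hqp]
  simp

end Conj

/-! ### The action on the set of lines -/

/-- Labels for the homogeneous lines inside the blocks. The lines of a block of type I form a
torsor under the dihedral group: `x_i` is labelled by the rotation `r i` and `y_i` by the reflection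
`sr i`. The line of `a_i` in a block of type II is labelled by `i`. Subscripts are the
actual subscripts modulo `l`. -/
abbrev BlockLine (l s r : ℕ) : Type :=
  (Fin s × DihedralGroup l) ⊕ (Fin r × ZMod l)

namespace BlockLine

variable {l s r : ℕ}

/-- The block containing a line. -/
def block : BlockLine l s r → Fin s ⊕ Fin r :=
  Sum.map Prod.fst Prod.fst

/-- The effect of `ad u` on lines; in a block of type I it is right multiplication by the generating
rotation. -/
def shift : BlockLine l s r → BlockLine l s r
  | .inl (j, g) => .inl (j, g * DihedralGroup.r 1)
  | .inr (t, i) => .inr (t, i + 1)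

/-- The only line of a block that does not commute with the given one; in a block of type I passing
to it is right multiplication by a reflection. -/
def dual : BlockLine l s r → BlockLine l s r
  | .inl (j, g) => .inl (j, g * DihedralGroup.sr 0)
  | .inr (t, i) => .inr (t, 1 - i)

theorem shift_iterate_inl (n : ℕ) (j : Fin s) (g : DihedralGroup l) :
    (shift (r := r))^[n] (.inl (j, g)) = .inl (j, g * DihedralGroup.r (n : ZMod l)) := by
  induction n with
  | zero => simp
  | succ n ih => rw [Function.iterate_succ_apply', ih]; simp [shift, mul_assoc]

theorem shift_iterate_inr (n : ℕ) (t : Fin r) (i : ZMod l) :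
    (shift (s := s))^[n] (.inr (t, i)) = .inr (t, i + n) := by
  induction n with
  | zero => simp
  | succ n ih => rw [Function.iterate_succ_apply', ih]; simp [shift, add_assoc]

theorem shift_iterate_period (v : BlockLine l s r) : shift^[l] v = v := by
  obtain ⟨j, g⟩ | ⟨t, i⟩ := v
  · rw [shift_iterate_inl, ZMod.natCast_self, ← DihedralGroup.one_def, mul_one]
  · rw [shift_iterate_inr, ZMod.natCast_self, add_zero]

theorem block_shift (v : BlockLine l s r) : (shift v).block = v.block := by
  obtain ⟨j, g⟩ | ⟨t, i⟩ := v <;> rfl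

theorem block_dual (v : BlockLine l s r) : (dual v).block = v.block := by
  obtain ⟨j, g⟩ | ⟨t, i⟩ := v <;> rfl

theorem block_shift_iterate (n : ℕ) (v : BlockLine l s r) : (shift^[n] v).block = v.block := by
  induction n with
  | zero => rfl
  | succ n ih => rw [Function.iterate_succ_apply', block_shift, ih]

/-- Blocks of type II are those in which the dual of a line is in its orbit under `shift`. -/
theorem exists_dual_eq_shift_iterate_iff [NeZero l] (v : BlockLine l s r) :
    (∃ n : ℕ, dual v = shift^[n] v) ↔ v.block.isRight := by
  obtain ⟨j, g⟩ | ⟨t, i⟩ := v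
  · simp [shift_iterate_inl, dual, block]
  · simp only [shift_iterate_inr, dual, block, Sum.map_inr, Sum.isRight_inr, iff_true]
    exact ⟨(1 - i - i).val, by simp⟩

/-- The embedding of `ℤ_2` in `ℤ_l` for even `l`. -/
def halfShift (l : ℕ) (e : Multiplicative (ZMod 2)) : ZMod l :=
  zmodPow (Multiplicative.ofAdd ((l / 2 : ℕ) : ZMod l)) e.toAdd |>.toAdd

theorem half_add_half (hl : Even l) : ((l / 2 : ℕ) : ZMod l) + ((l / 2 : ℕ) : ZMod l) = 0 := by
  obtain ⟨n, rfl⟩ := hl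
  have : (n + n) / 2 = n := by omega
  rw [this, ← Nat.cast_add, ZMod.natCast_self]

theorem ofAdd_half_sq (hl : Even l) :
    Multiplicative.ofAdd ((l / 2 : ℕ) : ZMod l) ^ 2 = 1 := by
  rw [pow_two, ← ofAdd_add, half_add_half hl, ofAdd_zero]

theorem halfShift_mul (hl : Even l) (e e' : Multiplicative (ZMod 2)) :
    halfShift l (e * e') = halfShift l e + halfShift l e' :=
  congrArg Multiplicative.toAdd (zmodPow_add (ofAdd_half_sq hl) e.toAdd e'.toAdd)

theorem halfShift_one (l : ℕ) : halfShift l 1 = 0 :=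
  congrArg Multiplicative.toAdd (zmodPow_zero (n := 2) _)

theorem halfShift_add_self (hl : Even l) (e : Multiplicative (ZMod 2)) :
    halfShift l e + halfShift l e = 0 := by
  rw [← halfShift_mul hl]
  revert e
  change ∀ e : ZMod 2, halfShift l (Multiplicative.ofAdd (e + e)) = 0
  intro e
  rw [CharTwo.add_self_eq_zero]
  exact halfShift_one l

theorem halfShift_ofAdd_one (l : ℕ) :
    halfShift l (Multiplicative.ofAdd 1) = ((l / 2 : ℕ) : ZMod l) := by
  change (Multiplicative.ofAdd ((l / 2 : ℕ) : ZMod l) ^ 1).toAdd = _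
  simp

theorem half_ne_zero [NeZero l] (hl : Even l) : ((l / 2 : ℕ) : ZMod l) ≠ 0 := by
  have hl0 : 0 < l := Nat.pos_of_ne_zero (NeZero.ne l)
  obtain ⟨n, rfl⟩ := hl
  rw [Ne, ZMod.natCast_eq_zero_iff]
  intro h
  have := Nat.le_of_dvd (by omega) h
  omega

theorem halfShift_injective [NeZero l] (hl : Even l) : Function.Injective (halfShift l) := by
  have h1 := half_ne_zero hl
  have key : ∀ e : ZMod 2, e = 0 ∨ e = 1 := by decide
  intro e e' h
  obtain he | he : e = 1 ∨ e = Multiplicative.ofAdd 1 := key e <;>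
    obtain he' | he' : e' = 1 ∨ e' = Multiplicative.ofAdd 1 := key e' <;>
    subst he he'
  · rfl
  · rw [halfShift_ofAdd_one, halfShift_one] at h
    exact absurd h.symm h1
  · rw [halfShift_ofAdd_one, halfShift_one] at h
    exact absurd h h1
  · rfl

theorem exists_halfShift_eq [NeZero l] (hl : Even l) {i : ZMod l} (hi : i + i = 0) :
    ∃ e, halfShift l e = i := by
  have hl0 : 0 < l := Nat.pos_of_ne_zero (NeZero.ne l)
  obtain ⟨a, rfl⟩ : ∃ a : ℕ, (a : ZMod l) = i := ⟨i.val, by simp⟩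
  rw [← Nat.cast_add, ZMod.natCast_eq_zero_iff] at hi
  obtain ⟨c, hc⟩ := hi
  obtain ⟨n, rfl⟩ := hl
  have ha : a = n * c := by
    have : (n + n) * c = 2 * (n * c) := by ring
    omega
  obtain ⟨d, rfl | rfl⟩ := Nat.even_or_odd' c
  · refine ⟨1, ?_⟩
    rw [halfShift_one, eq_comm, ZMod.natCast_eq_zero_iff]
    exact ⟨d, by rw [ha]; ring⟩
  · refine ⟨Multiplicative.ofAdd 1, ?_⟩
    have h2 : (n + n) / 2 = n := by omega
    have h3 : a = n + (n + n) * d := by rw [ha]; ring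
    rw [halfShift_ofAdd_one, h2, h3, Nat.cast_add, Nat.cast_mul, ZMod.natCast_self, zero_mul,
      add_zero]

/-- The action of `(S_s × S_r) ⋉ (D_l^s × ℤ_2^r)` on the lines: permutations move the blocks, and
the base group acts inside each block by left multiplication, respectively by adding `0` or
`l / 2` to the subscripts. -/
def act (g : FullBlockGroup l s r) : BlockLine l s r → BlockLine l s r
  | .inl (j, d) => .inl (g.right.1 j, g.left.1 (g.right.1 j) * d)
  | .inr (t, i) => .inr (g.right.2 t, halfShift l (g.left.2 (g.right.2 t)) + i)

theorem act_mul (hl : Even l) (g h : FullBlockGroup l s r) (v : BlockLine l s r) :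
    act (g * h) v = act g (act h v) := by
  obtain ⟨j, d⟩ | ⟨t, i⟩ := v
  · have : (g * h).left.1 (g.right.1 (h.right.1 j)) =
        g.left.1 (g.right.1 (h.right.1 j)) * h.left.1 (h.right.1 j) := by
      change g.left.1 _ * h.left.1 (g.right.1.symm (g.right.1 (h.right.1 j))) = _
      rw [Equiv.symm_apply_apply]
    change (Sum.inl (_, (g * h).left.1 (g.right.1 (h.right.1 j)) * d) : BlockLine l s r) = _
    rw [this, mul_assoc]
    rfl
  · have : (g * h).left.2 (g.right.2 (h.right.2 t)) =
        g.left.2 (g.right.2 (h.right.2 t)) * h.left.2 (h.right.2 t) := by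
      change g.left.2 _ * h.left.2 (g.right.2.symm (g.right.2 (h.right.2 t))) = _
      rw [Equiv.symm_apply_apply]
    change (Sum.inr (_, halfShift l ((g * h).left.2 (g.right.2 (h.right.2 t))) + i) :
      BlockLine l s r) = _
    rw [this, halfShift_mul hl, add_assoc]
    rfl

theorem act_one (v : BlockLine l s r) : act 1 v = v := by
  obtain ⟨j, d⟩ | ⟨t, i⟩ := v
  · change Sum.inl (j, 1 * d) = _
    rw [one_mul]
  · change Sum.inr (t, halfShift l 1 + i) = _
    rw [halfShift_one, zero_add]

theorem act_injective [NeZero l] (hl : Even l) :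
    Function.Injective (act : FullBlockGroup l s r → BlockLine l s r → BlockLine l s r) := by
  intro g h hgh
  have h1 : ∀ j, g.right.1 j = h.right.1 j ∧
      g.left.1 (g.right.1 j) * 1 = h.left.1 (h.right.1 j) * 1 := fun j => by
    simpa only [act, Sum.inl.injEq, Prod.mk.injEq] using congrFun hgh (.inl (j, 1))
  have h2 : ∀ t, g.right.2 t = h.right.2 t ∧
      halfShift l (g.left.2 (g.right.2 t)) + 0 = halfShift l (h.left.2 (h.right.2 t)) + 0 :=
    fun t => by
      simpa only [act, Sum.inr.injEq, Prod.mk.injEq] using congrFun hgh (.inr (t, 0))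
  have e1 : g.right.1 = h.right.1 := Equiv.ext fun j => (h1 j).1
  have e2 : g.right.2 = h.right.2 := Equiv.ext fun t => (h2 t).1
  refine SemidirectProduct.ext (Prod.ext (funext fun j => ?_) (funext fun t => ?_))
    (Prod.ext e1 e2)
  · have := (h1 (g.right.1.symm j)).2
    rwa [← e1, Equiv.apply_symm_apply, mul_one, mul_one] at this
  · have := (h2 (g.right.2.symm t)).2
    rw [← e2, Equiv.apply_symm_apply, add_zero, add_zero] at this
    exact halfShift_injective hl this

theorem act_shift (g : FullBlockGroup l s r) (v : BlockLine l s r) :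
    act g (shift v) = shift (act g v) := by
  obtain ⟨j, d⟩ | ⟨t, i⟩ := v
  · simp only [act, shift, mul_assoc]
  · simp only [act, shift, add_assoc]

theorem act_dual (hl : Even l) (g : FullBlockGroup l s r) (v : BlockLine l s r) :
    act g (dual v) = dual (act g v) := by
  obtain ⟨j, d⟩ | ⟨t, i⟩ := v
  · simp only [act, dual, mul_assoc]
  · simp only [act, dual, Sum.inr.injEq, Prod.mk.injEq, true_and]
    linear_combination halfShift_add_self hl (g.left.2 (g.right.2 t))

theorem block_act (g : FullBlockGroup l s r) (v : BlockLine l s r) :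
    (act g v).block = Sum.map g.right.1 g.right.2 v.block := by
  obtain ⟨j, d⟩ | ⟨t, i⟩ := v <;> rfl

/-- The group `(S_s × S_r) ⋉ (D_l^s × ℤ_2^r)` is the full symmetry group of the set of lines with
the maps `shift` and `dual`. A symmetry preserves the type of a block. On a block of type I the two
maps generate the right regular action of the dihedral group, so the symmetry is a left
multiplication there; on a block of type II it is a translation by some `e` with `2 e = 0`. -/
theorem exists_act_eq [NeZero l] (hl : Even l) {π : BlockLine l s r → BlockLine l s r}
    (hπ : Function.Injective π) (hshift : ∀ v, π (shift v) = shift (π v))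
    (hdual : ∀ v, π (dual v) = dual (π v)) : ∃ g : FullBlockGroup l s r, ∀ v, act g v = π v := by
  have hiter : ∀ (n : ℕ) v, π (shift^[n] v) = shift^[n] (π v) := fun n v => by
    induction n with
    | zero => rfl
    | succ n ih => rw [Function.iterate_succ_apply', hshift, ih, Function.iterate_succ_apply']
  have htype : ∀ v, (π v).block.isRight = v.block.isRight := fun v => by
    rw [Bool.eq_iff_iff, ← exists_dual_eq_shift_iterate_iff, ← exists_dual_eq_shift_iterate_iff]
    refine exists_congr fun n => ?_
    rw [← hdual, ← hiter, hπ.eq_iff]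
  have h1 : ∀ j, ∃ a : Fin s × DihedralGroup l, π (.inl (j, 1)) = .inl a := fun j => by
    cases hv : π (.inl (j, 1)) with
    | inl a => exact ⟨a, rfl⟩
    | inr a =>
      have := htype (.inl (j, 1))
      rw [hv] at this
      simp [block] at this
  have h2 : ∀ t, ∃ a : Fin r × ZMod l, π (.inr (t, 0)) = .inr a := fun t => by
    cases hv : π (.inr (t, 0)) with
    | inr a => exact ⟨a, rfl⟩
    | inl a =>
      have := htype (.inr (t, 0))
      rw [hv] at this
      simp [block] at this
  choose A hA using h1
  choose B hB using h2
  have hA' : ∀ j d, π (.inl (j, d)) = .inl ((A j).1, (A j).2 * d) := fun j d => by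
    have hrot : ∀ i : ZMod l, π (.inl (j, DihedralGroup.r i)) =
        .inl ((A j).1, (A j).2 * DihedralGroup.r i) := fun i => by
      have := hiter i.val (.inl (j, 1))
      rwa [hA, shift_iterate_inl, shift_iterate_inl, ZMod.natCast_zmod_val, one_mul] at this
    obtain i | i := d
    · exact hrot i
    · have := hdual (.inl (j, DihedralGroup.r (-i)))
      rw [hrot] at this
      simpa [dual, mul_assoc] using this
  have hB' : ∀ t i, π (.inr (t, i)) = .inr ((B t).1, (B t).2 + i) := fun t i => by
    have := hiter i.val (.inr (t, 0))
    rwa [hB, shift_iterate_inr, shift_iterate_inr, ZMod.natCast_zmod_val, zero_add] at this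
  have hB2 : ∀ t, ∃ e, halfShift l e = (B t).2 := fun t => by
    refine exists_halfShift_eq hl ?_
    have := hdual (.inr (t, 0))
    simp only [dual, hB', Sum.inr.injEq, Prod.mk.injEq, true_and] at this
    linear_combination this
  choose E hE using hB2
  have hη : Function.Injective fun j => (A j).1 := fun j j' (h : (A j).1 = (A j').1) => by
    have h1 : π (.inl (j, (A j).2⁻¹)) = π (.inl (j', (A j').2⁻¹)) := by
      rw [hA', hA', h, mul_inv_cancel, mul_inv_cancel]
    have := hπ h1
    simp only [Sum.inl.injEq, Prod.mk.injEq] at this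
    exact this.1
  have hσ : Function.Injective fun t => (B t).1 := fun t t' (h : (B t).1 = (B t').1) => by
    have h1 : π (.inr (t, -(B t).2)) = π (.inr (t', -(B t').2)) := by
      rw [hB', hB', h, add_neg_cancel, add_neg_cancel]
    have := hπ h1
    simp only [Sum.inr.injEq, Prod.mk.injEq] at this
    exact this.1
  let η : Equiv.Perm (Fin s) := Equiv.ofBijective _ (Finite.injective_iff_bijective.1 hη)
  let σ : Equiv.Perm (Fin r) := Equiv.ofBijective _ (Finite.injective_iff_bijective.1 hσ)
  refine ⟨⟨(fun j => (A (η.symm j)).2, fun t => E (σ.symm t)), (η, σ)⟩, ?_⟩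
  rintro (⟨j, d⟩ | ⟨t, i⟩)
  · rw [hA']
    change Sum.inl (η j, (A (η.symm (η j))).2 * d) = _
    rw [Equiv.symm_apply_apply]
    rfl
  · rw [hB', ← hE]
    change Sum.inr (σ t, halfShift l (E (σ.symm (σ t))) + i) = _
    rw [Equiv.symm_apply_apply]
    rfl

end BlockLine

/-! ### Structure constants in a basis adapted to the blocks -/

section Sign

variable {F : Type*} [Field F] {l s r : ℕ}

theorem zmodPow_neg {M : Type*} [Group M] {n : ℕ} [NeZero n] {g : M} (hg : g ^ n = 1)
    (i : ZMod n) : zmodPow g (-i) = (zmodPow g i)⁻¹ :=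
  eq_inv_of_mul_eq_one_left (by rw [← zmodPow_add hg, neg_add_cancel, zmodPow_zero])

theorem zmodPow_neg_one_neg [NeZero l] (hl : Even l) (i : ZMod l) :
    zmodPow (-1 : Fˣ) (-i) = zmodPow (-1 : Fˣ) i := by
  rw [zmodPow_neg hl.neg_one_pow, zmodPow, ← inv_pow, inv_neg_one]

/-- The linear character of the dihedral group of order `2 l`, `l` even, that is `-1` on the
rotation `r 1` and on the reflection `sr 0`. -/
def dihedralSign (F : Type*) [Field F] : DihedralGroup l → Fˣ
  | .r i => zmodPow (-1) i
  | .sr i => -zmodPow (-1) i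

theorem dihedralSign_mul [NeZero l] (hl : Even l) (g h : DihedralGroup l) :
    dihedralSign F (g * h) = dihedralSign F g * dihedralSign F h := by
  have hadd := zmodPow_add (n := l) (hl.neg_one_pow : (-1 : Fˣ) ^ l = 1)
  have hneg := zmodPow_neg_one_neg (F := F) hl
  obtain i | i := g <;> obtain j | j := h <;>
    simp [dihedralSign, sub_eq_add_neg, hadd, hneg, mul_comm]

/-- The sign in the bracket of a line with its dual. -/
def lineSign (F : Type*) [Field F] : BlockLine l s r → Fˣ
  | .inl (_, g) => dihedralSign F g
  | .inr (_, i) => zmodPow (-1) i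

end Sign

section Adapted

variable {F L G : Type*} [Field F] [LieRing L] [LieAlgebra F L] {l s r : ℕ}

/-- A block basis relabelled by `Bool ⊕ BlockLine l s r`, where `inl false` is `z` and `inl true`
is `u`. The function `κ` gives the parameter of each block. -/
structure IsAdaptedBasis (κ : Fin s ⊕ Fin r → Fˣ) (b : Basis (Bool ⊕ BlockLine l s r) F L) :
    Prop where
  lie_z : ∀ w : L, ⁅b (.inl false), w⁆ = 0
  lie_u : ∀ v, ⁅b (.inl true), b (.inr v)⁆ = κ v.block • b (.inr v.shift)
  lie_line : ∀ v w, ⁅b (.inr v), b (.inr w)⁆ =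
    if w = v.dual then (lineSign F v * κ v.block) • b (.inl false) else 0

/-- The passage from an element `i` of `Fin l` to the subscript `i + 1` modulo `l`. -/
noncomputable def subscript (l : ℕ) [NeZero l] : Fin l ≃ ZMod l :=
  Equiv.ofBijective (fun i => ((((i : ℕ) + 1 : ℕ)) : ZMod l)) <| by
    rw [Fintype.bijective_iff_injective_and_card, ZMod.card, Fintype.card_fin]
    refine ⟨fun i j h => ?_, rfl⟩
    simp only [Nat.cast_add, Nat.cast_one, add_left_inj] at h
    rw [ZMod.natCast_eq_natCast_iff', Nat.mod_eq_of_lt i.2, Nat.mod_eq_of_lt j.2] at h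
    exact Fin.ext h

theorem subscript_apply [NeZero l] (i : Fin l) : subscript l i = (((i : ℕ) + 1 : ℕ) : ZMod l) :=
  rfl

theorem subscript_finRotate [NeZero l] (i : Fin l) :
    subscript l (finRotate l i) = subscript l i + 1 := by
  obtain _ | n := l
  · exact i.elim0
  · rw [subscript_apply, subscript_apply, finRotate_apply, Fin.val_add, Fin.val_one',
      Nat.add_mod_mod, Nat.cast_add, ZMod.natCast_mod]
    push_cast
    rfl

/-- The relabelling of a block basis by lines. -/
noncomputable def lineEquiv (l s r : ℕ) [NeZero l] : BlockIdx l s r ≃ Bool ⊕ BlockLine l s r where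
  toFun
    | .z => .inl false
    | .u => .inl true
    | .x j i => .inr (.inl (j, .r (subscript l i)))
    | .y j i => .inr (.inl (j, .sr (subscript l i)))
    | .a t i => .inr (.inr (t, subscript l i))
  invFun
    | .inl false => .z
    | .inl true => .u
    | .inr (.inl (j, .r i)) => .x j ((subscript l).symm i)
    | .inr (.inl (j, .sr i)) => .y j ((subscript l).symm i)
    | .inr (.inr (t, i)) => .a t ((subscript l).symm i)
  left_inv v := by cases v <;> simp
  right_inv v := by
    obtain (_ | _) | ⟨j, i | i⟩ | ⟨t, i⟩ := v <;> simp

theorem block_of_lineEquiv_eq [NeZero l] {w : BlockIdx l s r} {v : BlockLine l s r}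
    (h : lineEquiv l s r w = .inr v) : w.block = some v.block := by
  cases w <;> simp only [lineEquiv, Equiv.coe_fn_mk, Sum.inr.injEq, reduceCtorEq] at h <;>
    subst h <;> rfl

/-- In terms of lines, both types of blocks obey the same three rules. For even `l` the sign
`(-1) ^ i` depends only on `i` modulo `l`, and the exceptional case `lie_u_y_last` disappears. -/
theorem IsBlockBasis.isAdaptedBasis [NeZero l] (hl : Even l) {β : Fin s → Fˣ} {α : Fin r → Fˣ}
    {b : Basis (BlockIdx l s r) F L} (hb : IsBlockBasis l s r β α b) :
    IsAdaptedBasis (Sum.elim β α) (b.reindex (lineEquiv l s r)) := by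
  have hx : ∀ j i, b.reindex (lineEquiv l s r) (.inr (.inl (j, .r (subscript l i)))) =
      b (.x j i) := fun j i => by
    rw [Basis.reindex_apply]
    congr 1
    exact (lineEquiv l s r).symm_apply_apply (.x j i)
  have hy : ∀ j i, b.reindex (lineEquiv l s r) (.inr (.inl (j, .sr (subscript l i)))) =
      b (.y j i) := fun j i => by
    rw [Basis.reindex_apply]
    congr 1
    exact (lineEquiv l s r).symm_apply_apply (.y j i)
  have ha : ∀ t i, b.reindex (lineEquiv l s r) (.inr (.inr (t, subscript l i))) =
      b (.a t i) := fun t i => by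
    rw [Basis.reindex_apply]
    congr 1
    exact (lineEquiv l s r).symm_apply_apply (.a t i)
  have hz : b.reindex (lineEquiv l s r) (.inl false) = b .z := by
    rw [Basis.reindex_apply]; rfl
  have hu : b.reindex (lineEquiv l s r) (.inl true) = b .u := by
    rw [Basis.reindex_apply]; rfl
  have hsign : ∀ i : Fin l, ((zmodPow (-1 : Fˣ) (subscript l i) : Fˣ) : F) =
      (-1) ^ ((i : ℕ) + 1) := fun i => by
    rw [subscript_apply, zmodPow_natCast hl.neg_one_pow]
    push_cast
    rfl
  have hdvd : ∀ i j : Fin l, l ∣ ((i : ℕ) + 1) + ((j : ℕ) + 1) ↔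
      subscript l j = -subscript l i := fun i j => by
    rw [← ZMod.natCast_eq_zero_iff, Nat.cast_add, ← subscript_apply, ← subscript_apply, add_comm,
      add_eq_zero_iff_eq_neg]
  have hsum : ∀ i j : Fin l, ((i : ℕ) + 1) + ((j : ℕ) + 1) = l + 1 ↔
      subscript l j = 1 - subscript l i := fun i j => by
    rw [eq_sub_iff_add_eq, add_comm (subscript l j), subscript_apply, subscript_apply,
      ← Nat.cast_add, ← Nat.cast_one (R := ZMod l), ZMod.natCast_eq_natCast_iff]
    constructor
    · intro h
      rw [h]
      exact Nat.add_modEq_left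
    · intro h
      have h1 := (Nat.modEq_iff_dvd' (by omega)).1 h.symm
      obtain ⟨c, hc⟩ := h1
      have hi := i.2
      have hj := j.2
      have hc1 : c = 1 := by
        have h2 : 0 < c := Nat.pos_of_ne_zero (by rintro rfl; omega)
        have h3 : c < 2 := by
          by_contra h3
          have : l * 2 ≤ l * c := Nat.mul_le_mul_left l (by omega)
          omega
        omega
      subst hc1
      omega
  refine ⟨fun w => by rw [hz]; exact hb.central w, fun v => ?_, fun v w => ?_⟩
  · rw [hu]
    obtain ⟨j, i | i⟩ | ⟨t, i⟩ := v <;> obtain ⟨i, rfl⟩ := (subscript l).surjective i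
    · simp only [BlockLine.shift, BlockLine.block, DihedralGroup.r_mul_r, ← subscript_finRotate, hx]
      exact (hb.blockI j).lie_u_x i
    · simp only [BlockLine.shift, BlockLine.block, DihedralGroup.sr_mul_r, ← subscript_finRotate,
        hy]
      obtain h | h : (i : ℕ) + 1 < l ∨ (i : ℕ) + 1 = l := by omega
      · exact (hb.blockI j).lie_u_y i h
      · have := (hb.blockI j).lie_u_y_last i h
        rwa [hl.neg_one_pow, one_mul] at this
    · simp only [BlockLine.shift, BlockLine.block, ← subscript_finRotate, ha]
      exact (hb.blockII t).lie_u_a i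
  · by_cases hvw : v.block = w.block
    · obtain ⟨j, i | i⟩ | ⟨t, i⟩ := v <;> obtain ⟨j', i' | i'⟩ | ⟨t', i'⟩ := w <;>
        simp only [BlockLine.block, Sum.map_inl, Sum.map_inr, reduceCtorEq, Sum.inl.injEq,
          Sum.inr.injEq] at hvw <;>
        subst hvw <;>
        obtain ⟨i, rfl⟩ := (subscript l).surjective i <;>
        obtain ⟨i', rfl⟩ := (subscript l).surjective i'
      · rw [hx, hx, if_neg (by simp [BlockLine.dual])]
        exact (hb.blockI j).lie_x_x i i'
      · rw [hx, hy, (hb.blockI j).lie_x_y i i']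
        simp only [hdvd, BlockLine.dual, DihedralGroup.r_mul_sr, zero_sub, Sum.inl.injEq,
          Prod.mk.injEq, true_and, DihedralGroup.sr.injEq]
        split_ifs with h
        · rw [← hsign, h, zmodPow_neg_one_neg hl, hz]
          rfl
        · rfl
      · rw [hx, hy, ← lie_skew, (hb.blockI j).lie_x_y i' i]
        simp only [hdvd, BlockLine.dual, DihedralGroup.sr_mul_sr, zero_sub, Sum.inl.injEq,
          Prod.mk.injEq, true_and, DihedralGroup.r.injEq]
        have h' : subscript l i = -subscript l i' ↔ subscript l i' = -subscript l i :=
          by rw [eq_neg_iff_add_eq_zero, add_comm, ← eq_neg_iff_add_eq_zero]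
        simp only [← h']
        split_ifs with h
        · rw [← hsign, hz, ← neg_smul, ← neg_mul]
          rfl
        · exact neg_zero
      · rw [hy, hy, if_neg (by simp [BlockLine.dual])]
        exact (hb.blockI j).lie_y_y i i'
      · rw [ha, ha, (hb.blockII t).lie_a_a i i', hz]
        simp only [hsum, BlockLine.dual, Sum.inr.injEq, Prod.mk.injEq, true_and]
        rw [← hsign]
        rfl
    · rw [if_neg fun h => hvw (by rw [h, BlockLine.block_dual])]
      rw [Basis.reindex_apply, Basis.reindex_apply]
      refine hb.different _ _ v.block w.block (block_of_lineEquiv_eq ?_)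
        (block_of_lineEquiv_eq ?_) hvw <;> exact Equiv.apply_symm_apply _ _

/-! ### Automorphisms permute the lines by symmetries -/

namespace IsAdaptedBasis

variable {κ : Fin s ⊕ Fin r → Fˣ} {b : Basis (Bool ⊕ BlockLine l s r) F L}

theorem units_smul_ne_zero (b : Basis (Bool ⊕ BlockLine l s r) F L) (c : Fˣ)
    (i : Bool ⊕ BlockLine l s r) : c • b i ≠ 0 := by
  have := b.ne_zero i
  rwa [Ne, smul_eq_zero_iff_eq]

/-- Proportional basis vectors are equal, with equal coefficients. -/
theorem units_smul_eq_iff (b : Basis (Bool ⊕ BlockLine l s r) F L) {c d : Fˣ}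
    {i j : Bool ⊕ BlockLine l s r} : c • b i = d • b j ↔ i = j ∧ c = d := by
  constructor
  · intro h
    have h1 := congrArg b.repr h
    simp only [Units.smul_def, map_smul, Basis.repr_self, Finsupp.smul_single, smul_eq_mul,
      mul_one] at h1
    rw [Finsupp.single_eq_single_iff] at h1
    obtain ⟨h1, h2⟩ | ⟨h1, -⟩ := h1
    · exact ⟨h1, Units.ext h2⟩
    · exact absurd h1 c.ne_zero
  · rintro ⟨rfl, rfl⟩
    rfl

/-- The derived algebra has no component along `u`. -/
theorem repr_lie_u (hb : IsAdaptedBasis κ b) (x y : L) : b.repr ⁅x, y⁆ (.inl true) = 0 := by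
  have key : (LieModule.toEnd F L L : L →ₗ[F] L →ₗ[F] L).compr₂ (b.coord (.inl true)) = 0 := by
    refine LinearMap.ext_basis b b fun i j => ?_
    change b.repr ⁅b i, b j⁆ (.inl true) = 0
    obtain (_ | _) | v := i
    · simp [hb.lie_z]
    · obtain (_ | _) | w := j
      · rw [← lie_skew, hb.lie_z]
        simp
      · simp
      · rw [hb.lie_u]
        simp [Units.smul_def]
    · obtain (_ | _) | w := j
      · rw [← lie_skew, hb.lie_z]
        simp
      · rw [← lie_skew, hb.lie_u]
        simp [Units.smul_def]
      · rw [hb.lie_line]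
        split_ifs
        · simp [Units.smul_def]
        · simp
  exact congrArg (fun φ : L →ₗ[F] L →ₗ[F] F => φ x y) key

theorem exists_shift_eq [NeZero l] (v : BlockLine l s r) : ∃ w, BlockLine.shift w = v := by
  refine ⟨BlockLine.shift^[l - 1] v, ?_⟩
  rw [← Function.iterate_succ_apply' BlockLine.shift, Nat.succ_eq_add_one,
    Nat.sub_add_cancel (Nat.pos_of_ne_zero (NeZero.ne l)), BlockLine.shift_iterate_period]

theorem exists_perm_of_mem_gradingAut [NeZero l] {Γ : G → Submodule F L}
    (hΓ : gradingComponents Γ = Set.range fun v => Submodule.span F {b v}) {f : L ≃ₗ[F] L}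
    (hf : f ∈ gradingAut Γ) : ∃ (π : Equiv.Perm (Bool ⊕ BlockLine l s r))
      (c : Bool ⊕ BlockLine l s r → Fˣ), ∀ i, f (b i) = c i • b (π i) := by
  have key : ∀ i, ∃ (k : Bool ⊕ BlockLine l s r) (c : Fˣ), f (b i) = c • b k := fun i => by
    have h1 : (Submodule.span F {b i}).map (f : L →ₗ[F] L) ∈ gradingComponents Γ := by
      rw [← hf.2]
      exact ⟨_, by rw [hΓ]; exact ⟨i, rfl⟩, rfl⟩
    rw [hΓ, Submodule.map_span, Set.image_singleton] at h1
    obtain ⟨k, hk⟩ := h1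
    obtain ⟨c, hc⟩ := Submodule.span_singleton_eq_span_singleton.1 hk
    exact ⟨k, c, hc.symm⟩
  choose π c hπ using key
  have hinj : Function.Injective π := fun i j hij => by
    have h1 : f (c j • b i) = f (c i • b j) := by
      rw [Units.smul_def, Units.smul_def, map_smul, map_smul, hπ, hπ, hij, ← Units.smul_def,
        ← Units.smul_def, smul_comm]
    exact ((units_smul_eq_iff b).1 (f.injective h1)).1
  exact ⟨Equiv.ofBijective π (Finite.injective_iff_bijective.1 hinj), c, hπ⟩

/-- An automorphism that permutes the homogeneous lines fixes the line of `z`, which is the centre,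
and the line of `u`, the only one outside the derived algebra. On the remaining lines it acts by a
symmetry, and comparing its coefficients along an orbit of `ad u` relates the parameters of a block
and of its image. -/
theorem exists_act_of_mem_gradingAut [NeZero l] [Nonempty (BlockLine l s r)] (hl : Even l)
    (hb : IsAdaptedBasis κ b) {Γ : G → Submodule F L}
    (hΓ : gradingComponents Γ = Set.range fun v => Submodule.span F {b v}) {f : L ≃ₗ[F] L}
    (hf : f ∈ gradingAut Γ) : ∃ (g : FullBlockGroup l s r) (μ ζ : Fˣ),
      f (b (.inl false)) = ζ • b (.inl false) ∧ f (b (.inl true)) = μ • b (.inl true) ∧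
      (∀ v, ∃ c : Fˣ, f (b (.inr v)) = c • b (.inr (BlockLine.act g v))) ∧
      ∀ v : BlockLine l s r, κ v.block ^ l = (μ * κ (BlockLine.act g v).block) ^ l := by
  obtain ⟨π, c, hπ⟩ := exists_perm_of_mem_gradingAut hΓ hf
  have hlie : ∀ i j, ⁅f (b i), f (b j)⁆ = (c i * c j) • ⁅b (π i), b (π j)⁆ := fun i j => by
    rw [hπ, hπ]
    simp only [Units.smul_def, smul_lie, lie_smul, smul_smul, Units.val_mul]
    rw [mul_comm]
  -- Only `z` is central among the basis vectors.
  have hz : π (.inl false) = .inl false := by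
    have hcentral : ∀ w, ⁅b (π (.inl false)), b w⁆ = 0 := fun w => by
      obtain ⟨i, rfl⟩ := π.surjective w
      have h1 := hlie (.inl false) i
      rw [← hf.1, hb.lie_z, map_zero] at h1
      exact ((smul_eq_zero_iff_eq _).1 h1.symm)
    generalize π (.inl false) = i at hcentral
    obtain (_ | _) | v := i
    · rfl
    · obtain ⟨v⟩ := ‹Nonempty (BlockLine l s r)›
      exact absurd ((hb.lie_u v).symm.trans (hcentral _)) (units_smul_ne_zero b _ _)
    · have h1 := hcentral (.inr v.dual)
      rw [hb.lie_line, if_pos rfl] at h1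
      exact absurd h1 (units_smul_ne_zero b _ _)
  have hu : π (.inl true) = .inl true := by
    obtain ⟨i, hi⟩ := π.surjective (.inl true)
    obtain (_ | _) | v := i
    · rw [hz] at hi
      simp at hi
    · exact hi
    -- A line of a block lies in the derived algebra, so it cannot be mapped to the line of `u`.
    · exfalso
      obtain ⟨w, rfl⟩ := exists_shift_eq v
      have h1 := congrArg f (hb.lie_u w)
      rw [hf.1, Units.smul_def, map_smul, hπ (.inr w.shift), hi, ← Units.smul_def, smul_smul] at h1
      have h2 := hb.repr_lie_u (f (b (.inl true))) (f (b (.inr w)))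
      rw [h1, Units.smul_def, map_smul] at h2
      simp at h2
  have hline : ∀ v : BlockLine l s r, ∃ w : BlockLine l s r, π (.inr v) = .inr w := fun v => by
    cases hv : π (.inr v) with
    | inr w => exact ⟨w, rfl⟩
    | inl e =>
      cases e
      · rw [← hz] at hv
        simpa using π.injective hv
      · rw [← hu] at hv
        simpa using π.injective hv
  choose ρ hρ using hline
  have hinj : Function.Injective ρ := fun v w h => by
    have h1 : π (.inr v) = π (.inr w) := by rw [hρ, hρ, h]
    simpa using π.injective h1
  have hshift : ∀ v, ρ v.shift = (ρ v).shift ∧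
      κ v.block * c (.inr v.shift) = c (.inl true) * c (.inr v) * κ (ρ v).block := fun v => by
    have h1 := hlie (.inl true) (.inr v)
    rw [← hf.1, hb.lie_u, hu, hρ, hb.lie_u, Units.smul_def, map_smul, hπ, ← Units.smul_def, hρ,
      smul_smul, smul_smul, units_smul_eq_iff b] at h1
    simpa using h1
  have hdual : ∀ v, ρ v.dual = (ρ v).dual := fun v => by
    have h1 := hlie (.inr v) (.inr v.dual)
    rw [← hf.1, hb.lie_line, if_pos rfl, hρ, hρ, hb.lie_line, Units.smul_def, map_smul, hπ,
      ← Units.smul_def] at h1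
    by_contra h2
    rw [if_neg h2, smul_smul, smul_zero] at h1
    exact units_smul_ne_zero b _ _ h1
  obtain ⟨g, hg⟩ := BlockLine.exists_act_eq hl hinj (fun v => (hshift v).1) hdual
  refine ⟨g, c (.inl true), c (.inl false), by rw [hπ, hz], by rw [hπ, hu],
    fun v => ⟨c (.inr v), by rw [hπ, hρ, hg]⟩, fun v => ?_⟩
  -- After `l` steps along the orbit of `ad u` the coefficient returns to its initial value.
  have hiter : ∀ n : ℕ, κ v.block ^ n * c (.inr (BlockLine.shift^[n] v)) =
      (c (.inl true) * κ (ρ v).block) ^ n * c (.inr v) ∧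
      ρ (BlockLine.shift^[n] v) = BlockLine.shift^[n] (ρ v) := fun n => by
    induction n with
    | zero => simp
    | succ n ih =>
      have h1 := hshift (BlockLine.shift^[n] v)
      rw [Function.iterate_succ_apply', Function.iterate_succ_apply', h1.1, ih.2]
      refine ⟨?_, rfl⟩
      rw [ih.2, BlockLine.block_shift_iterate, BlockLine.block_shift_iterate] at h1
      calc _ = κ v.block ^ n * (κ v.block * c (.inr (BlockLine.shift^[n] v).shift)) := by
            rw [pow_succ, mul_assoc]
        _ = (κ v.block ^ n * c (.inr (BlockLine.shift^[n] v))) *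
            (c (.inl true) * κ (ρ v).block) := by rw [h1.2]; ac_rfl
        _ = _ := by rw [ih.1, pow_succ]; ac_rfl
  have h1 := (hiter l).1
  rw [BlockLine.shift_iterate_period] at h1
  rw [hg]
  exact mul_right_cancel h1

/-- Coefficients compatible with the structure constants turn a symmetry of the lines into an
automorphism, normalized so that it fixes `z`. -/
theorem exists_mem_gradingAut_of_coeff (hb : IsAdaptedBasis κ b) {Γ : G → Submodule F L}
    (hΓ : gradingComponents Γ = Set.range fun v => Submodule.span F {b v})
    (π : Equiv.Perm (BlockLine l s r)) (μ : Fˣ) (c : BlockLine l s r → Fˣ)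
    (hshift : ∀ v, π v.shift = (π v).shift) (hdual : ∀ v, π v.dual = (π v).dual)
    (hc : ∀ v, κ v.block * c v.shift = μ * c v * κ (π v).block)
    (hc' : ∀ v, c v * c v.dual * (lineSign F (π v) * κ (π v).block) =
      lineSign F v * κ v.block) :
    ∃ f ∈ gradingAut Γ, ∀ v, f (b (.inr v)) = c v • b (.inr (π v)) := by
  let π' : Equiv.Perm (Bool ⊕ BlockLine l s r) := Equiv.sumCongr (Equiv.refl _) π
  let c' : Bool ⊕ BlockLine l s r → Fˣ := Sum.elim (fun e => cond e μ 1) c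
  let f : L ≃ₗ[F] L := b.equiv (b.unitsSMul (c' ∘ π'.symm)) π'
  have hf : ∀ i, f (b i) = c' i • b (π' i) := fun i => by
    rw [Basis.equiv_apply, Basis.unitsSMul_apply, Function.comp_apply, Equiv.symm_apply_apply]
  have hfz : f (b (.inl false)) = b (.inl false) := (hf _).trans (one_smul _ _)
  have hfu : f (b (.inl true)) = μ • b (.inl true) := hf _
  have hfv : ∀ v, f (b (.inr v)) = c v • b (.inr (π v)) := fun v => hf _
  have hu : ∀ v, f ⁅b (.inl true), b (.inr v)⁆ = ⁅f (b (.inl true)), f (b (.inr v))⁆ := fun v => by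
    rw [hb.lie_u, hfu, hfv]
    simp only [Units.smul_def, map_smul, smul_lie, lie_smul]
    rw [hfv, hb.lie_u, hshift]
    simp only [← Units.smul_def, smul_smul, hc]
    congr 1
    ac_rfl
  have key : (LieModule.toEnd F L L : L →ₗ[F] L →ₗ[F] L).compr₂ (f : L →ₗ[F] L) =
      (LieModule.toEnd F L L : L →ₗ[F] L →ₗ[F] L).compl₁₂ (f : L →ₗ[F] L) (f : L →ₗ[F] L) := by
    refine LinearMap.ext_basis b b fun i j => ?_
    change f ⁅b i, b j⁆ = ⁅f (b i), f (b j)⁆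
    obtain (_ | _) | v := i
    · rw [hfz, hb.lie_z, hb.lie_z, map_zero]
    · obtain (_ | _) | w := j
      · rw [hfz, ← lie_skew, hb.lie_z, ← lie_skew, hb.lie_z, neg_zero, map_zero]
      · rw [lie_self, lie_self, map_zero]
      · exact hu w
    · obtain (_ | _) | w := j
      · rw [hfz, ← lie_skew, hb.lie_z, ← lie_skew, hb.lie_z, neg_zero, map_zero]
      · rw [← lie_skew, map_neg, hu, lie_skew]
      · rw [hfv, hfv, hb.lie_line]
        simp only [Units.smul_def, smul_lie, lie_smul]
        rw [hb.lie_line]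
        simp only [← hdual, π.injective.eq_iff]
        split_ifs with h
        · subst h
          simp only [map_smul, Units.smul_def, smul_smul, hfz]
          congr 1
          have := congrArg Units.val (hc' v)
          push_cast at this ⊢
          rw [← this]
          ring
        · simp
  refine ⟨f, ⟨fun x y => congrArg (fun φ : L →ₗ[F] L →ₗ[F] L => φ x y) key, ?_⟩, hfv⟩
  have hmap : ∀ i, (Submodule.span F {b i}).map (f : L →ₗ[F] L) = Submodule.span F {b (π' i)} :=
    fun i => by
      rw [Submodule.map_span, Set.image_singleton]
      change Submodule.span F {f (b i)} = _
      rw [hf, Submodule.span_singleton_group_smul_eq]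
  rw [hΓ, ← Set.range_comp]
  have : (fun V : Submodule F L => V.map (f : L →ₗ[F] L)) ∘
      (fun v => Submodule.span F {b v}) = (fun v => Submodule.span F {b v}) ∘ π' := funext hmap
  rw [this, π'.surjective.range_comp]

end IsAdaptedBasis

end Adapted

/-! ### Symmetries induced by automorphisms -/

section Realization

variable {F L G : Type*} [Field F] [LieRing L] [LieAlgebra F L] {l s r : ℕ}

theorem zmodPow_neg_one_mul_self (i : ZMod l) :
    zmodPow (-1 : Fˣ) i * zmodPow (-1 : Fˣ) i = 1 := by
  rw [zmodPow, ← mul_pow, neg_mul_neg, one_mul, one_pow]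

theorem dihedralSign_mul_self (g : DihedralGroup l) :
    dihedralSign F g * dihedralSign F g = 1 := by
  obtain i | i := g <;> simp [dihedralSign, zmodPow_neg_one_mul_self]

/-- A symmetry of the lines as a permutation. -/
def actPerm (hl : Even l) (g : FullBlockGroup l s r) : Equiv.Perm (BlockLine l s r) where
  toFun := BlockLine.act g
  invFun := BlockLine.act g⁻¹
  left_inv v := by rw [← BlockLine.act_mul hl, inv_mul_cancel, BlockLine.act_one]
  right_inv v := by rw [← BlockLine.act_mul hl, mul_inv_cancel, BlockLine.act_one]

namespace IsAdaptedBasis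

variable {κ : Fin s ⊕ Fin r → Fˣ} {b : Basis (Bool ⊕ BlockLine l s r) F L}

/-- A symmetry is induced by an automorphism as soon as it changes the `l`-th powers of the
parameters by a common factor. The coefficients along an orbit of `ad u` form a geometric
progression with ratio an `l`-th root of unity; the free constant of a block is adjusted so that `z`
is fixed, which for a block of type II takes a square root. -/
theorem exists_mem_gradingAut [IsAlgClosed F] [NeZero l] (hl : Even l) (hb : IsAdaptedBasis κ b)
    {Γ : G → Submodule F L} (hΓ : gradingComponents Γ = Set.range fun v => Submodule.span F {b v})
    (g : FullBlockGroup l s r) (μ : Fˣ)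
    (h : ∀ B, κ B ^ l = (μ * κ (Sum.map g.right.1 g.right.2 B)) ^ l) :
    ∃ f ∈ gradingAut Γ, ∀ v, ∃ c : Fˣ, f (b (.inr v)) = c • b (.inr (BlockLine.act g v)) := by
  let κ' : Fin s ⊕ Fin r → Fˣ := fun B => κ (Sum.map g.right.1 g.right.2 B)
  -- The ratio of consecutive coefficients, forced by compatibility with `ad u`.
  let ω : Fin s ⊕ Fin r → Fˣ := fun B => μ * κ' B * (κ B)⁻¹
  have hω : ∀ B, ω B ^ l = 1 := fun B => by
    rw [mul_pow, ← h, ← mul_pow, mul_inv_cancel, one_pow]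
  have hsqrt : ∀ x : Fˣ, ∃ y : Fˣ, y * y = x := fun x => by
    obtain ⟨y, hy⟩ := IsAlgClosed.exists_pow_nat_eq (x : F) two_pos
    have hy0 : y ≠ 0 := by
      rintro rfl
      exact x.ne_zero (by rw [← hy]; simp)
    exact ⟨Units.mk0 y hy0, Units.ext (by rw [← hy, pow_two]; rfl)⟩
  choose sqrt hsqrt using hsqrt
  let a : Fin s → Fˣ := fun j =>
    dihedralSign F (g.left.1 (g.right.1 j)) * κ (.inl j) * (κ' (.inl j))⁻¹
  let a' : Fin r → Fˣ := fun t =>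
    sqrt (zmodPow (-1) (BlockLine.halfShift l (g.left.2 (g.right.2 t))) * κ (.inr t) *
      (κ' (.inr t) * ω (.inr t))⁻¹)
  let c : BlockLine l s r → Fˣ
    | .inl (j, .r i) => zmodPow (ω (.inl j)) i
    | .inl (j, .sr i) => zmodPow (ω (.inl j)) i * a j
    | .inr (t, i) => zmodPow (ω (.inr t)) i * a' t
  have hcshift : ∀ v, c v.shift = c v * ω v.block := fun v => by
    obtain ⟨j, i | i⟩ | ⟨t, i⟩ := v <;>
      simp only [BlockLine.shift, BlockLine.block, DihedralGroup.r_mul_r, DihedralGroup.sr_mul_r,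
        c, Sum.map_inl, Sum.map_inr, zmodPow_add (hω _), zmodPow_one (hω _), mul_right_comm]
  have hinv : ∀ B (i : ZMod l), zmodPow (ω B) (-i) = (zmodPow (ω B) i)⁻¹ :=
    fun B i => zmodPow_neg (hω B) i
  have hc : ∀ v, κ v.block * c v.shift = μ * c v * κ (BlockLine.act g v).block := fun v => by
    rw [hcshift, BlockLine.block_act]
    change κ v.block * (c v * (μ * κ' v.block * (κ v.block)⁻¹)) = μ * c v * κ' v.block
    rw [← mul_assoc (c v), mul_left_comm, mul_comm (κ v.block), inv_mul_cancel, mul_one]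
    ac_rfl
  have hc' : ∀ v, c v * c v.dual * (lineSign F (BlockLine.act g v) *
      κ (BlockLine.act g v).block) = lineSign F v * κ v.block := fun v => by
    rw [BlockLine.block_act]
    change _ * (_ * κ' v.block) = _
    obtain ⟨j, d⟩ | ⟨t, i⟩ := v
    · have h1 : c (.inl (j, d)) * c (BlockLine.dual (.inl (j, d))) = a j := by
        obtain i | i := d <;>
          simp only [BlockLine.dual, DihedralGroup.r_mul_sr, DihedralGroup.sr_mul_sr, zero_sub, c,
            hinv, mul_inv_cancel_left, mul_inv_cancel_comm]
      rw [h1]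
      change _ * (dihedralSign F (g.left.1 (g.right.1 j) * d) * κ' (.inl j)) =
        dihedralSign F d * κ (.inl j)
      have h2 := dihedralSign_mul_self (F := F) (g.left.1 (g.right.1 j))
      rw [dihedralSign_mul hl]
      calc _ = dihedralSign F (g.left.1 (g.right.1 j)) * dihedralSign F (g.left.1 (g.right.1 j)) *
            ((κ' (.inl j))⁻¹ * κ' (.inl j)) * (dihedralSign F d * κ (.inl j)) := by
              simp only [a]; ac_rfl
        _ = _ := by rw [h2, inv_mul_cancel, one_mul, one_mul]
    · set e := BlockLine.halfShift l (g.left.2 (g.right.2 t)) with he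
      have h1 : c (.inr (t, i)) * c (BlockLine.dual (.inr (t, i))) =
          ω (.inr t) * (a' t * a' t) := by
        simp only [BlockLine.dual, c, sub_eq_add_neg, zmodPow_add (hω _), zmodPow_one (hω _), hinv]
        calc _ = zmodPow (ω (.inr t)) i * (zmodPow (ω (.inr t)) i)⁻¹ *
              (ω (.inr t) * (a' t * a' t)) := by ac_rfl
          _ = _ := by rw [mul_inv_cancel, one_mul]
      rw [h1, hsqrt]
      change _ * (zmodPow (-1) (e + i) * κ' (.inr t)) = zmodPow (-1) i * κ (.inr t)
      rw [zmodPow_add hl.neg_one_pow]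
      calc _ = (κ' (.inr t) * ω (.inr t)) * (κ' (.inr t) * ω (.inr t))⁻¹ *
            (zmodPow (-1) e * zmodPow (-1) e) * (zmodPow (-1) i * κ (.inr t)) := by ac_rfl
        _ = _ := by rw [zmodPow_neg_one_mul_self, mul_inv_cancel, one_mul, one_mul]
  obtain ⟨f, hf, hf'⟩ := hb.exists_mem_gradingAut_of_coeff hΓ (actPerm hl g) μ c
    (BlockLine.act_shift g) (BlockLine.act_dual hl g) hc hc'
  exact ⟨f, hf, fun v => ⟨c v, hf' v⟩⟩

theorem act_unique [NeZero l] (hl : Even l) {b : Basis (Bool ⊕ BlockLine l s r) F L}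
    {f : L ≃ₗ[F] L} {g h : FullBlockGroup l s r}
    (hg : ∀ v, ∃ c : Fˣ, f (b (.inr v)) = c • b (.inr (BlockLine.act g v)))
    (hh : ∀ v, ∃ c : Fˣ, f (b (.inr v)) = c • b (.inr (BlockLine.act h v))) : g = h := by
  refine BlockLine.act_injective hl (funext fun v => ?_)
  obtain ⟨c, hc⟩ := hg v
  obtain ⟨d, hd⟩ := hh v
  exact Sum.inr_injective ((units_smul_eq_iff b).1 (hc.symm.trans hd)).1

/-- The Weyl group is the group of all symmetries of the lines that change the `l`-th powers of the
parameters by a common factor. -/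
theorem exists_weylGroup_hom [IsAlgClosed F] [NeZero l] [Nonempty (BlockLine l s r)] (hl : Even l)
    (hb : IsAdaptedBasis κ b) {Γ : G → Submodule F L}
    (hΓ : gradingComponents Γ = Set.range fun v => Submodule.span F {b v}) :
    ∃ Θ : gradingAut Γ →* FullBlockGroup l s r,
      Θ.ker = (gradingStab Γ).subgroupOf (gradingAut Γ) ∧
      ∀ g, g ∈ Θ.range ↔
        ∃ μ : Fˣ, ∀ B, κ B ^ l = (μ * κ (Sum.map g.right.1 g.right.2 B)) ^ l := by
  choose θ μ ζ hζ hμ hθ hκ using fun f : gradingAut Γ =>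
    exists_act_of_mem_gradingAut hl hb hΓ f.2
  have hone : ∀ v, ∃ c : Fˣ, (1 : L ≃ₗ[F] L) (b (.inr v)) =
      c • b (.inr (BlockLine.act (1 : FullBlockGroup l s r) v)) := fun v =>
    ⟨1, by rw [BlockLine.act_one, one_smul]; rfl⟩
  let Θ : gradingAut Γ →* FullBlockGroup l s r :=
    { toFun := θ
      map_one' := act_unique hl (hθ 1) hone
      map_mul' := fun f f' => by
        refine act_unique hl (hθ (f * f')) fun v => ?_
        obtain ⟨c, hc⟩ := hθ f' v
        obtain ⟨d, hd⟩ := hθ f (BlockLine.act (θ f') v)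
        refine ⟨c * d, ?_⟩
        change (f : L ≃ₗ[F] L) ((f' : L ≃ₗ[F] L) (b (.inr v))) = _
        rw [hc, Units.smul_def, map_smul, hd, ← Units.smul_def, smul_smul,
          BlockLine.act_mul hl] }
  refine ⟨Θ, ?_, fun g => ⟨?_, ?_⟩⟩
  · ext f
    rw [MonoidHom.mem_ker, Subgroup.mem_subgroupOf]
    constructor
    · intro h1
      have h1 : θ f = 1 := h1
      refine ⟨f.2.1, fun i => ?_⟩
      by_cases h0 : Γ i = ⊥
      · rw [h0, Submodule.map_bot]
      · have hi : Γ i ∈ gradingComponents Γ := ⟨h0, i, rfl⟩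
        rw [hΓ] at hi
        obtain ⟨v, hv⟩ := hi
        obtain ⟨c, hc⟩ : ∃ c : Fˣ, (f : L ≃ₗ[F] L) (b v) = c • b v := by
          obtain (_ | _) | v := v
          · exact ⟨_, hζ f⟩
          · exact ⟨_, hμ f⟩
          · have h2 := hθ f v
            rwa [h1, BlockLine.act_one] at h2
        rw [← hv, Submodule.map_span, Set.image_singleton]
        change Submodule.span F {(f : L ≃ₗ[F] L) (b v)} = _
        rw [hc, Submodule.span_singleton_group_smul_eq]
    · intro h1
      refine act_unique hl (hθ f) fun v => ?_
      have hi : Submodule.span F {b (.inr v)} ∈ gradingComponents Γ := by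
        rw [hΓ]
        exact ⟨_, rfl⟩
      obtain ⟨-, i, hi⟩ := hi
      have h2 := h1.2 i
      rw [hi, Submodule.map_span, Set.image_singleton] at h2
      obtain ⟨c, hc⟩ := Submodule.span_singleton_eq_span_singleton.1 h2.symm
      exact ⟨c, by rw [BlockLine.act_one]; exact hc.symm⟩
  · rintro ⟨f, rfl⟩
    refine ⟨μ f, fun B => ?_⟩
    obtain j | t := B
    · exact hκ f (.inl (j, 1))
    · exact hκ f (.inr (t, 0))
  · rintro ⟨ν, hν⟩
    obtain ⟨f, hf, hf'⟩ := hb.exists_mem_gradingAut hl hΓ g ν hν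
    exact ⟨⟨f, hf⟩, act_unique hl (hθ ⟨f, hf⟩) hf'⟩

end IsAdaptedBasis

end Realization

/-! ### The group of symmetries that translate the classes -/

section Translating

variable {C : Type*} [CommGroup C] {l s r s' r' : ℕ} {m : Fin s' → ℕ} {n : Fin r' → ℕ}

/-- The pair of permutations of the blocks multiplies the classes `x` and `y` of the blocks
by `h`. -/
def Translates (x : Fin s → C) (y : Fin r → C) (h : C)
    (ρ : Equiv.Perm (Fin s) × Equiv.Perm (Fin r)) : Prop :=
  (∀ j, x (ρ.1 j) = h * x j) ∧ ∀ t, y (ρ.2 t) = h * y t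

variable {x : Fin s → C} {y : Fin r → C}

theorem Translates.one : Translates x y 1 1 := ⟨fun j => by simp, fun t => by simp⟩

theorem Translates.mul {h h' : C} {ρ ρ' : Equiv.Perm (Fin s) × Equiv.Perm (Fin r)}
    (H : Translates x y h ρ) (H' : Translates x y h' ρ') :
    Translates x y (h * h') (ρ * ρ') :=
  ⟨fun j => by rw [Prod.fst_mul, Equiv.Perm.mul_apply, H.1, H'.1, mul_assoc],
    fun t => by rw [Prod.snd_mul, Equiv.Perm.mul_apply, H.2, H'.2, mul_assoc]⟩

theorem Translates.inv {h : C} {ρ : Equiv.Perm (Fin s) × Equiv.Perm (Fin r)}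
    (H : Translates x y h ρ) : Translates x y h⁻¹ ρ⁻¹ := by
  refine ⟨fun j => ?_, fun t => ?_⟩
  · rw [eq_inv_mul_iff_mul_eq, ← H.1]
    exact congrArg x (ρ.1.apply_symm_apply j)
  · rw [eq_inv_mul_iff_mul_eq, ← H.2]
    exact congrArg y (ρ.2.apply_symm_apply t)

theorem Translates.pow {h : C} {ρ : Equiv.Perm (Fin s) × Equiv.Perm (Fin r)}
    (H : Translates x y h ρ) (k : ℕ) : Translates x y (h ^ k) (ρ ^ k) := by
  induction k with
  | zero => simpa using Translates.one
  | succ k ih => rw [pow_succ, pow_succ]; exact ih.mul H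

theorem Translates.unique (hsr : 0 < s ∨ 0 < r) {h h' : C}
    {ρ : Equiv.Perm (Fin s) × Equiv.Perm (Fin r)} (H : Translates x y h ρ)
    (H' : Translates x y h' ρ) : h = h' := by
  obtain hs | hr := hsr
  · exact mul_right_cancel ((H.1 ⟨0, hs⟩).symm.trans (H'.1 ⟨0, hs⟩))
  · exact mul_right_cancel ((H.2 ⟨0, hr⟩).symm.trans (H'.2 ⟨0, hr⟩))

theorem innerToFull_injective (eβ : (Σ i, Fin (m i)) ≃ Fin s) (eα : (Σ i, Fin (n i)) ≃ Fin r) :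
    Function.Injective (innerToFull l eβ eα) := by
  intro w w' h
  have h0 : w.left = w'.left :=
    congrArg (fun g : FullBlockGroup l s r => g.left) h
  refine SemidirectProduct.ext h0 ?_
  have h1 : youngHom eβ eα w.right = youngHom eβ eα w'.right :=
    congrArg (fun g : FullBlockGroup l s r => g.right) h
  refine Prod.ext ?_ ?_
  · exact Equiv.Perm.sigmaCongrRightHom_injective
      (eβ.permCongrHom.injective (congrArg Prod.fst h1))
  · exact Equiv.Perm.sigmaCongrRightHom_injective
      (eα.permCongrHom.injective (congrArg Prod.snd h1))

/-- `InnerGroup` consists of the symmetries that preserve the classes. -/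
theorem mem_range_innerToFull_iff (eβ : (Σ i, Fin (m i)) ≃ Fin s)
    (eα : (Σ i, Fin (n i)) ≃ Fin r) {d : Fin s' → C} {c : Fin r' → C}
    (hd : Function.Injective d) (hc : Function.Injective c) (hx : ∀ i, x (eβ i) = d i.1)
    (hy : ∀ i, y (eα i) = c i.1) (g : FullBlockGroup l s r) :
    g ∈ (innerToFull l eβ eα).range ↔ Translates x y 1 g.right := by
  simp only [Translates, one_mul]
  rw [← mem_range_sigmaCongrRightHom_iff eβ hd hx, ← mem_range_sigmaCongrRightHom_iff eα hc hy]
  constructor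
  · rintro ⟨w, rfl⟩
    exact ⟨⟨w.right.1, rfl⟩, ⟨w.right.2, rfl⟩⟩
  · rintro ⟨⟨w, hw⟩, ⟨w', hw'⟩⟩
    exact ⟨⟨g.left, (w, w')⟩, SemidirectProduct.ext rfl (Prod.ext hw hw')⟩

/-- The symmetries that translate the classes form the quotient of `InnerGroup ⋊ ℤ_p`: the
permutations `η`, `σ` that keep the positions of the blocks inside their classes have order
dividing `q`, so they define an action of `ℤ_p`, and the elements of `q ℤ_p` act trivially. -/
theorem exists_semidirectProduct_hom (hsr : 0 < s ∨ 0 < r) (eβ : (Σ i, Fin (m i)) ≃ Fin s)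
    (eα : (Σ i, Fin (n i)) ≃ Fin r) {d : Fin s' → C} {c : Fin r' → C}
    (hd : Function.Injective d) (hc : Function.Injective c) (hx : ∀ i, x (eβ i) = d i.1)
    (hy : ∀ i, y (eα i) = c i.1) {p q : ℕ} (hp : 0 < p) {h : C} (hq : q = orderOf h)
    (hqp : q ∣ p) (hhx : h ∈ multisetStabilizer (Finset.univ.val.map x))
    (hhy : h ∈ multisetStabilizer (Finset.univ.val.map y))
    (hgen : ∀ h' : C, h' ∈ multisetStabilizer (Finset.univ.val.map x) →
      h' ∈ multisetStabilizer (Finset.univ.val.map y) → ∃ k : ℕ, h' = h ^ k) :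
    ∃ (η : Equiv.Perm (Fin s)) (σ : Equiv.Perm (Fin r))
      (φ : Multiplicative (ZMod p) →* MulAut (InnerGroup l eβ eα))
      (Ψ : InnerGroup l eβ eα ⋊[φ] Multiplicative (ZMod p) →* FullBlockGroup l s r),
      Translates x y h (η, σ) ∧
      (∀ w, innerToFull l eβ eα (φ (Multiplicative.ofAdd 1) w) =
        SemidirectProduct.inr (η, σ) * innerToFull l eβ eα w *
          (SemidirectProduct.inr (η, σ))⁻¹) ∧
      Ψ.ker.map SemidirectProduct.rightHom =
        Subgroup.zpowers (Multiplicative.ofAdd (q : ZMod p)) ∧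
      Nonempty (Ψ.ker ≃* Multiplicative (ZMod (p / q))) ∧
      ∀ g, g ∈ Ψ.range ↔ ∃ h', Translates x y h' g.right := by
  have : NeZero p := ⟨hp.ne'⟩
  obtain ⟨η, hη, hη'⟩ := exists_perm_label_position eβ hd hx hhx
  obtain ⟨σ, hσ, hσ'⟩ := exists_perm_label_position eα hc hy hhy
  have htr : Translates x y h (η, σ) := ⟨hη, hσ⟩
  have hhq : h ^ q = 1 := by rw [hq, pow_orderOf_eq_one]
  have hηq : η ^ q = 1 := perm_pow_eq_one_of_label_position eβ hd hx hη hη' hhq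
  have hσq : σ ^ q = 1 := perm_pow_eq_one_of_label_position eα hc hy hσ hσ' hhq
  let ρ : FullBlockGroup l s r := SemidirectProduct.inr (η, σ)
  have hρq : ρ ^ q = 1 := by
    rw [← map_pow, Prod.pow_mk, hηq, hσq]
    exact map_one _
  have hρp : ρ ^ p = 1 := by
    obtain ⟨a, rfl⟩ := hqp
    rw [pow_mul, hρq, one_pow]
  let τ : Multiplicative (ZMod p) →* FullBlockGroup l s r := zmodPowHom ρ hρp
  have hτ1 : τ (Multiplicative.ofAdd 1) = ρ := zmodPow_one hρp
  have hτk : ∀ k : ℕ, τ (Multiplicative.ofAdd (k : ZMod p)) = ρ ^ k := zmodPow_natCast hρp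
  have hρtr : ∀ k : ℕ, Translates x y (h ^ k) (ρ ^ k).right := fun k => by
    rw [← map_pow]
    exact htr.pow k
  have hτtr : ∀ t, ∃ k : ℕ, t = Multiplicative.ofAdd (k : ZMod p) ∧
      Translates x y (h ^ k) (τ t).right := fun t =>
    ⟨t.toAdd.val, by rw [ZMod.natCast_zmod_val]; rfl, hρtr _⟩
  have hrange := mem_range_innerToFull_iff (l := l) eβ eα hd hc hx hy
  obtain ⟨φ, hφ⟩ := exists_mulAut_of_conj (innerToFull l eβ eα) (innerToFull_injective eβ eα) τ
    fun t w => by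
      obtain ⟨k, -, hk⟩ := hτtr t
      rw [hrange]
      have hw := (hrange _).1 ⟨w, rfl⟩
      have := (hk.mul hw).mul hk.inv
      rwa [mul_one, mul_inv_cancel] at this
  have hτ : ∀ t, τ t ∈ (innerToFull l eβ eα).range ↔
      t ∈ Subgroup.zpowers (Multiplicative.ofAdd (q : ZMod p)) := fun t => by
    constructor
    · intro ht
      obtain ⟨k, rfl, hk⟩ := hτtr t
      have h1 : h ^ k = 1 := hk.unique hsr ((hrange _).1 ht)
      obtain ⟨a, rfl⟩ : q ∣ k := hq ▸ orderOf_dvd_of_pow_eq_one h1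
      refine ⟨a, ?_⟩
      simp only [zpow_natCast]
      rw [← ofAdd_nsmul, nsmul_eq_mul, Nat.cast_mul, mul_comm]
    · rintro ⟨a, rfl⟩
      simp only [map_zpow]
      rw [hτk, hρq, one_zpow]
      exact one_mem _
  obtain ⟨Ψ, hΨ, hker, hker'⟩ := exists_quotient_mulEquiv_range hp hqp (innerToFull l eβ eα)
    (innerToFull_injective eβ eα) τ φ hφ hτ
  refine ⟨η, σ, φ, Ψ, htr, fun w => by rw [hφ, hτ1], hker, hker', fun g => ⟨?_, ?_⟩⟩
  · rintro ⟨w, rfl⟩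
    obtain ⟨k, -, hk⟩ := hτtr w.right
    rw [hΨ]
    exact ⟨_, ((hrange _).1 ⟨w.left, rfl⟩).mul hk⟩
  · rintro ⟨h', hg⟩
    obtain ⟨k, rfl⟩ := hgen h' (mem_multisetStabilizer_of_perm _ hg.1)
      (mem_multisetStabilizer_of_perm _ hg.2)
    have h1 : Translates x y 1 (g * (ρ ^ k)⁻¹).right := by
      have := hg.mul (hρtr k).inv
      rwa [mul_inv_cancel] at this
    obtain ⟨w, hw⟩ := (hrange _).2 h1
    refine ⟨⟨w, Multiplicative.ofAdd (k : ZMod p)⟩, ?_⟩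
    rw [hΨ, hτk, hw, inv_mul_cancel_right]

end Translating

/-! ### The Weyl group of a block grading of the twisted Heisenberg algebra -/

theorem hatClass_eq_iff {F : Type*} [Field F] {l : ℕ} {a c : Fˣ} :
    hatClass l a = hatClass l c ↔ a ^ l = c ^ l := by
  rw [hatClass, hatClass, QuotientGroup.eq, mem_rootsOfUnity, mul_pow, inv_pow, inv_mul_eq_one]

/-- A basis that consists of `z` and `u` only is impossible because `L` is not abelian. -/
theorem TwistedHeisenberg.exists_block {F : Type*} [Field F] {k : ℕ} (hk : 0 < k)
    {lam : Fin k → F} (hlam : ∀ i, lam i ≠ 0) {l s r : ℕ} {β : Fin s → Fˣ} {α : Fin r → Fˣ}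
    {b : Basis (BlockIdx l s r) F (TwistedHeisenberg lam)} (hb : IsBlockBasis l s r β α b) :
    0 < l ∧ (0 < s ∨ 0 < r) := by
  by_contra hcon
  have hidx : ∀ v : BlockIdx l s r, v = .z ∨ v = .u := fun v => by
    cases v with
    | z => exact .inl rfl
    | u => exact .inr rfl
    | x j i => exact absurd ⟨i.pos, .inl j.pos⟩ hcon
    | y j i => exact absurd ⟨i.pos, .inl j.pos⟩ hcon
    | a t i => exact absurd ⟨i.pos, .inr t.pos⟩ hcon
  have key : (LieModule.toEnd F (TwistedHeisenberg lam) (TwistedHeisenberg lam) :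
      TwistedHeisenberg lam →ₗ[F] TwistedHeisenberg lam →ₗ[F] TwistedHeisenberg lam) = 0 := by
    refine LinearMap.ext_basis b b fun v w => ?_
    change ⁅b v, b w⁆ = 0
    obtain rfl | rfl := hidx v
    · exact hb.central _
    · obtain rfl | rfl := hidx w
      · rw [← lie_skew, hb.central, neg_zero]
      · exact lie_self _
  let e : TwistedHeisenberg lam := ⟨0, 1, 0, 0⟩
  let e' : TwistedHeisenberg lam := ⟨0, 0, fun _ => 1, 0⟩
  have h1 : ⁅e, e'⁆ = 0 := congrArg (fun φ : TwistedHeisenberg lam →ₗ[F]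
    TwistedHeisenberg lam →ₗ[F] TwistedHeisenberg lam => φ e e') key
  have h2 := congrFun (congrArg TwistedHeisenberg.ch h1) ⟨0, hk⟩
  rw [TwistedHeisenberg.lie_ch] at h2
  simp [e, e', hlam] at h2

theorem mainTheorem9 {F : Type*} [Field F] [IsAlgClosed F] [CharZero F]
    {k : ℕ} (hk : 0 < k) (lam : Fin k → F) (hlam : ∀ i, lam i ≠ 0)
    {G : Type*} [AddCommGroup G] [DecidableEq G]
    (Γ : G → Submodule F (TwistedHeisenberg lam)) [GradedLieAlgebra Γ]
    (l s r : ℕ) (hl : Even l) (β : Fin s → Fˣ) (α : Fin r → Fˣ)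
    (hΓ : IsBlockGrading Γ l s r β α)
    (s' r' : ℕ) (m : Fin s' → ℕ) (n : Fin r' → ℕ) (δ : Fin s' → Fˣ) (γ : Fin r' → Fˣ)
    (hδ : Function.Injective fun i => hatClass l (δ i))
    (hγ : Function.Injective fun i => hatClass l (γ i))
    (eβ : (Σ i, Fin (m i)) ≃ Fin s) (eα : (Σ i, Fin (n i)) ≃ Fin r)
    (hβ : ∀ i, hatClass l (β (eβ i)) = hatClass l (δ i.1))
    (hα : ∀ i, hatClass l (α (eα i)) = hatClass l (γ i.1)) :
    ∃ p : ℕ, IsGreatest (splittingOrders l β α) p ∧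
      ∀ ε : Fˣ, IsPrimitiveRoot ε p →
      ∀ q : ℕ, IsLeast {q : ℕ | 0 < q ∧ hatClass l ε ^ q = 1} q →
        q ∣ p ∧
        ∃ (η : Equiv.Perm (Fin s)) (σ : Equiv.Perm (Fin r))
          (φ : Multiplicative (ZMod p) →* MulAut (InnerGroup l eβ eα)),
          (∀ j, hatClass l (β (η j)) = hatClass l ε * hatClass l (β j)) ∧
          (∀ t, hatClass l (α (σ t)) = hatClass l ε * hatClass l (α t)) ∧
          (∀ w, innerToFull l eβ eα (φ (Multiplicative.ofAdd 1) w) =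
            SemidirectProduct.inr (η, σ) * innerToFull l eβ eα w *
              (SemidirectProduct.inr (η, σ))⁻¹) ∧
          ∃ (K : Subgroup (InnerGroup l eβ eα ⋊[φ] Multiplicative (ZMod p))) (_ : K.Normal),
            K.map SemidirectProduct.rightHom =
              Subgroup.zpowers (Multiplicative.ofAdd (q : ZMod p)) ∧
            Nonempty (K ≃* Multiplicative (ZMod (p / q))) ∧
            Nonempty (weylGroup Γ ≃*
              (InnerGroup l eβ eα ⋊[φ] Multiplicative (ZMod p)) ⧸ K) := by
  obtain ⟨b, hb, hcomp⟩ := hΓ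
  obtain ⟨hl0, hsr⟩ := TwistedHeisenberg.exists_block hk hlam hb
  have : NeZero l := ⟨hl0.ne'⟩
  have : Nonempty (BlockLine l s r) := by
    obtain hs | hr := hsr
    · exact ⟨.inl (⟨0, hs⟩, 1)⟩
    · exact ⟨.inr (⟨0, hr⟩, 0)⟩
  obtain ⟨p, hp, hp0, hpow⟩ := exists_isGreatest_splittingOrders hl0 hsr β α
  have : NeZero p := ⟨hp0.ne'⟩
  refine ⟨p, hp, fun ε hε q hq => ?_⟩
  have hgen : ∀ μ ∈ scalingSubgroup l β α, ∀ ε' : Fˣ, IsPrimitiveRoot ε' p →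
      ∃ k : ℕ, ε' ^ k = μ := fun μ hμ ε' hε' => by
    have h1 := IsPrimitiveRoot.coe_units_iff.2 hε'
    obtain ⟨k, -, hk⟩ := h1.eq_pow_of_pow_eq_one (ξ := (μ : F))
      (by rw [← Units.val_pow_eq_pow_val, hpow μ hμ, Units.val_one])
    exact ⟨k, Units.ext (by exact_mod_cast hk)⟩
  have hεmem : ε ∈ scalingSubgroup l β α := by
    obtain ⟨⟨-, ε₀, hε₀, hA, hB⟩, -⟩ := hp
    rw [splitsBy_iff hp0 hε₀.pow_eq_one] at hA hB
    have h0 : ε₀ ∈ scalingSubgroup l β α := ⟨hA, hB⟩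
    have h1 := IsPrimitiveRoot.coe_units_iff.2 hε₀
    obtain ⟨k, -, hk⟩ := h1.eq_pow_of_pow_eq_one (ξ := (ε : F))
      (by rw [← Units.val_pow_eq_pow_val, hε.pow_eq_one, Units.val_one])
    have hk' : ε₀ ^ k = ε := Units.ext (by exact_mod_cast hk)
    exact hk' ▸ Subgroup.pow_mem _ h0 k
  have hhp : hatClass l ε ^ p = 1 := by
    rw [hatClass, ← QuotientGroup.mk_pow, hε.pow_eq_one, QuotientGroup.mk_one]
  have hqord : q = orderOf (hatClass l ε) := by
    refine le_antisymm (hq.2 ⟨?_, pow_orderOf_eq_one _⟩) (orderOf_le_of_pow_eq_one hq.1.1 hq.1.2)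
    exact orderOf_pos_iff.2 (isOfFinOrder_iff_pow_eq_one.2 ⟨p, hp0, hhp⟩)
  have hqp : q ∣ p := hqord ▸ orderOf_dvd_of_pow_eq_one hhp
  refine ⟨hqp, ?_⟩
  obtain ⟨η, σ, φ, Ψ, htr, hφ, hK, hK', hΨ⟩ := exists_semidirectProduct_hom (l := l)
    (x := fun j => hatClass l (β j)) (y := fun t => hatClass l (α t)) hsr eβ eα hδ hγ hβ hα hp0
    hqord hqp hεmem.2 hεmem.1 fun h' hx hy => by
      obtain ⟨μ, rfl⟩ := QuotientGroup.mk_surjective h'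
      obtain ⟨k, rfl⟩ := hgen μ ⟨hy, hx⟩ ε hε
      exact ⟨k, QuotientGroup.mk_pow _ _ _⟩
  refine ⟨η, σ, φ, htr.1, htr.2, hφ, Ψ.ker, inferInstance, hK, hK', ?_⟩
  have hcomp' : gradingComponents Γ =
      Set.range fun v => Submodule.span F {b.reindex (lineEquiv l s r) v} := by
    rw [hcomp, ← (lineEquiv l s r).symm.surjective.range_comp]
    simp only [Basis.reindex_apply]
    rfl
  obtain ⟨Θ, hΘ, hΘ'⟩ := (hb.isAdaptedBasis hl).exists_weylGroup_hom hl hcomp'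
  have hrange : Θ.range = Ψ.range := by
    ext g
    rw [hΘ', hΨ]
    -- An automorphism that scales `u` by `μ` translates the classes by the inverse of that of `μ`.
    constructor
    · rintro ⟨μ, hμ⟩
      have key : ∀ B, hatClass l (Sum.elim β α (Sum.map g.right.1 g.right.2 B)) =
          (hatClass l μ)⁻¹ * hatClass l (Sum.elim β α B) := fun B => by
        rw [eq_inv_mul_iff_mul_eq, eq_comm, hatClass_eq_iff.2 (hμ B)]
        rfl
      exact ⟨_, fun j => key (.inl j), fun t => key (.inr t)⟩
    · rintro ⟨h', hh⟩
      obtain ⟨μ, rfl⟩ := QuotientGroup.mk_surjective h'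
      refine ⟨μ⁻¹, fun B => hatClass_eq_iff.1 ?_⟩
      change _ = (hatClass l μ)⁻¹ * hatClass l _
      rw [eq_inv_mul_iff_mul_eq, eq_comm]
      obtain j | t := B
      · exact hh.1 j
      · exact hh.2 t
  exact ⟨(QuotientGroup.quotientMulEquivOfEq hΘ.symm).trans
    ((QuotientGroup.quotientKerEquivRange Θ).trans
      ((MulEquiv.subgroupCongr hrange).trans (QuotientGroup.quotientKerEquivRange Ψ).symm))⟩
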